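/- Let $k$ be a field, $S=k[x_1,\dots,x_n]$ with its $\mathbb N^n$-multigrading, and let $M\subsetneq S$ be a proper monomial ideal minimally generated by monomials $m_1,\dots,m_r$. Let $L_M$ be its lcm-lattice (the lcm's of subsets of $\{m_1,\dots,m_r\}$, ordered by divisibility, with bottom $1$ and atoms $m_1,\dots,m_r$), and for $m\in L_M$ put $A_m=\{i : m_i\mid m\}$. Let $\Omega$ be the simplex on $\{1,\dots,r\}$ with augmented boundary map $d$, a face with $i$ elements (including $\emptyset$, $i=0$) being placed in homological degree $i$. The multidegree of a face $A$ is $\mathrm{lcm}(m_i\mid i\in A)$, and that of a chain is the lcm of the multidegrees of the faces occurring in it with nonzero coefficient. *Conventions.* All complexes are finite, live in degrees $\ge 0$, and carry a fixed finite (multigraded, over $S$) basis. Two complexes are equal if there is an isomorphism inducing a bijection of the fixed bases; a subcomplex is one equal to the span of some of the basis elements. An exact closure of a complex $\mathbb U$ of $k$-vector spaces is an exact complex containing $\mathbb U$ as a subcomplex and of minimal total dimension among these. The frame of a multigraded complex is the complex of $k$-vector spaces obtained by setting all $x_i=1$. $\mathbf F(\le m)$ (resp. $\mathbf F(<m)$)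 is the subcomplex of $\mathbf F$ spanned by the basis elements whose multidegree divides (resp. strictly divides) $m$. If $\mathbf T$ is the Taylor resolution of $S/M$, with the faces of $\Omega$ as basis, a Taylor basis of a minimal multigraded free resolution $\mathbf F$ of $S/M$ is the set $B$ of chains in $\Omega$ obtained, for some trivial complex $\mathcal E$ (a direct sum of complexes $0\to S(-u)\xrightarrow{1}S(-u)\to0$, $u$ a monomial) and some multigraded isomorphism $\mathbf F\oplus\mathcal E\cong\mathbf T$, by setting $x_1=\dots=x_n=1$ in the images in $\mathbf T$ of the basis elements of $\mathbf F$. *Construction.* Sets of chains $\Gamma_m$ $(m\in L_M)$ are chosen inductively: $\Gamma_1=\{\lambda\emptyset\}$ and $\Gamma_{m_i}=\{\lambda_i\{i\}\}$ with nonzero scalars $\lambda,\lambda_i$; if $m$ is neither $1$ nor an atom, let $\mathbb U_m$ be the complex with basis $\bigcup_{m'<m}\Gamma_{m'}$ and differential $d$, choose an exact closure $\mathbb V_m$ of $\mathbb U_m$, and replace each basis element $f$ of $\mathbb V_m$ not in $\mathbb U_m$ by a chain $g$ with vertices in $A_m$, of the same homological degree, whose boundary $d(g)$ is the differential of $f$;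 $\Gamma_m$ is the set of these $g$. For $m\ne1$, $(\mathbb V_m,d)$ is the resulting complex with basis $\bigcup_{m'\le m}\Gamma_{m'}$ and differential $d$. An atomic lattice resolution of $S/M$ is a complex equal to the $M$-homogenization of the complex with basis $\bigcup_{m\in L_M}\Gamma_m$ and differential $d$, for some such choice of the $\Gamma_m$: the basis element in degree $0$ has multidegree $1$, the one spanned by $\{i\}$ has multidegree $m_i$, a basis element $v$ in degree $\ge2$ has as multidegree the lcm of the multidegrees of the basis elements $u$ occurring in $d(v)$, and the coefficient $\alpha$ of $u$ in $d(v)$ is replaced by $\alpha\,\mathrm{mdeg}(v)/\mathrm{mdeg}(u)$. **Theorem.** Let $\mathbf F$ be a minimal multigraded free resolution of $S/M$ with a Taylor basis $B$. For $m\in L_M$ let $\widetilde\Gamma_m=\{f\in B : \mathrm{mdeg}(f)=m\}$. For $m\neq1$ in $L_M$, the frame $\widetilde{\mathbb V}_m$ of $\mathbf F(\le m)$ is a complex with basis $\bigcup_{m'\le m}\widetilde\Gamma_{m'}$ and differential $d$, and the frame of $\mathbf F(<m)$ is a complex with basis $\bigcup_{m'<m}\widetilde\Gamma_{m'}$ and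 differential $d$ (each basis element of $\mathbf F$ being identified with the corresponding element of $B$). In the Construction one can take $\Gamma_m=\widetilde\Gamma_m$ for all $m\in L_M$, and then $(\mathbb V_m,d)=(\widetilde{\mathbb V}_m,d)$ for all $m\ne1$ in $L_M$. In particular, $\mathbf F$ is an atomic lattice resolution of $S/M$. -/

import Mathlib

open Finsupp

universe u v w

/-! ### Complexes of free modules with a fixed basis -/

/-- A finite complex of finitely generated free `R`-modules, concentrated in nonnegative
homological degrees, with a fixed basis `ι i` in homological degree `i`; the module in degree `i`
is `ι i →₀ R`, and `d i` is the differential from degree `i + 1` to degree `i`. -/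
structure BasedComplex (R : Type u) [CommRing R] where
  ι : ℕ → Type v
  finite : Finite (Σ i, ι i)
  d : ∀ i, (ι (i + 1) →₀ R) →ₗ[R] (ι i →₀ R)
  d_comp_d : ∀ i, d i ∘ₗ d (i + 1) = 0

namespace BasedComplex

variable {R : Type u} [CommRing R]

/-- The total rank, i.e. the number of all basis elements. -/
noncomputable def totalRank (C : BasedComplex.{u, v} R) : ℕ := Nat.card (Σ i, C.ι i)

/-- Exactness in all homological degrees, including degree `0`. -/
def IsExact (C : BasedComplex.{u, v} R) : Prop :=
  Function.Surjective (C.d 0) ∧ ∀ i, Function.Exact (C.d (i + 1)) (C.d i)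

/-- Equality of complexes with fixed bases: an isomorphism of complexes that is induced by a
bijection between the fixed bases. -/
structure Same (C : BasedComplex.{u, v} R) (D : BasedComplex.{u, w} R) where
  equiv : ∀ i, C.ι i ≃ D.ι i
  comm : ∀ i (b : C.ι (i + 1)),
    D.d i (single (equiv (i + 1) b) 1) = mapDomain (equiv i) (C.d i (single b 1))

/-- `U` is a subcomplex of `V`: some of the basis elements of `V` span a complex which is equal
(with its basis) to `U`. -/
structure Sub (U : BasedComplex.{u, v} R) (V : BasedComplex.{u, w} R) where
  emb : ∀ i, U.ι i ↪ V.ι i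
  comm : ∀ i (b : U.ι (i + 1)),
    V.d i (single (emb (i + 1) b) 1) = mapDomain (emb i) (U.d i (single b 1))

/-- `V`, containing `U` as a subcomplex, is an exact closure of `U`: it is exact and of minimal
total dimension among the exact complexes that contain `U` as a subcomplex. -/
def Sub.IsExactClosure {U : BasedComplex.{u, v} R} {V : BasedComplex.{u, w} R}
    (_j : Sub U V) : Prop :=
  V.IsExact ∧ ∀ W : BasedComplex.{u, w} R, W.IsExact → Nonempty (Sub U W) →
    V.totalRank ≤ W.totalRank

/-- The subcomplex spanned by a set of basis elements that is stable under the differential. -/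
noncomputable def restrict (C : BasedComplex.{u, v} R) (p : ∀ i, C.ι i → Prop)
    (hp : ∀ i b, p (i + 1) b → ∀ a, C.d i (single b 1) a ≠ 0 → p i a) :
    BasedComplex.{u, v} R where
  ι i := {b : C.ι i // p i b}
  finite := by
    have := C.finite
    exact Finite.of_injective
      (fun x : (Σ i, {b : C.ι i // p i b}) => (⟨x.1, x.2.1⟩ : Σ i, C.ι i)) (by
        rintro ⟨i, b, hb⟩ ⟨j, c, hc⟩ h
        simp only [Sigma.mk.injEq] at h
        obtain ⟨rfl, h⟩ := h
        simp only [heq_eq_eq] at h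
        subst h
        rfl)
  d i := lsubtypeDomain {b | p i b} ∘ₗ C.d i ∘ₗ
    lmapDomain R R (Subtype.val : {b : C.ι (i + 1) // p (i + 1) b} → C.ι (i + 1))
  d_comp_d i := by
    ext ⟨b, hb⟩ ⟨a, ha⟩
    have key : mapDomain (Subtype.val : {b : C.ι (i + 1) // p (i + 1) b} → C.ι (i + 1))
        (subtypeDomain (fun b => p (i + 1) b) (C.d (i + 1) (single b 1)))
          = C.d (i + 1) (single b 1) := by
      ext c
      by_cases hc : p (i + 1) c
      · exact mapDomain_apply Subtype.val_injective _ (⟨c, hc⟩ : {b // p (i + 1) b})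
      · rw [mapDomain_of_notMem_range _ _ (by simpa using hc)]
        by_contra h
        exact hc (hp (i + 1) b hb c (Ne.symm h))
    have h2 := LinearMap.congr_fun (C.d_comp_d i) (single b 1)
    simp only [LinearMap.comp_apply, LinearMap.zero_apply] at h2
    have h3 : (C.d i (C.d (i + 1) (single b 1))) a = 0 := by rw [h2]; rfl
    have h4 : (C.d i (mapDomain (Subtype.val : {b : C.ι (i + 1) // p (i + 1) b} → C.ι (i + 1))
        (subtypeDomain (fun b => p (i + 1) b) (C.d (i + 1) (single b 1))))) a = 0 := by
      rw [key]; exact h3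
    simpa [lsubtypeDomain, mapDomain_single] using h4

theorem restrict_d_single (C : BasedComplex.{u, v} R) (p : ∀ i, C.ι i → Prop)
    (hp : ∀ i b, p (i + 1) b → ∀ a, C.d i (single b 1) a ≠ 0 → p i a) (i : ℕ)
    (b : C.ι (i + 1)) (hb : p (i + 1) b) (a : C.ι i) (ha : p i a) :
    (C.restrict p hp).d i (single (⟨b, hb⟩ : {b // p (i + 1) b}) 1) (⟨a, ha⟩ : {a // p i a})
      = C.d i (single b 1) a := by
  have h : (C.restrict p hp).d i (single (⟨b, hb⟩ : {b // p (i + 1) b}) 1)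
      (⟨a, ha⟩ : {a // p i a})
      = C.d i (mapDomain Subtype.val (single (⟨b, hb⟩ : {b // p (i + 1) b}) 1)) a := rfl
  rw [h, mapDomain_single]

end BasedComplex

/-! ### Complexes of multigraded free modules over the polynomial ring -/

section Multigraded

variable {k : Type u} [Field k] {n : ℕ}

/-- An element of the multigraded free module with basis `ι`, the basis element `a` being of
multidegree `x ^ deg a`, is multigraded of multidegree `x ^ μ` (zero is allowed). -/
def IsMultigraded {ι : Type v} (deg : ι → (Fin n →₀ ℕ)) (μ : Fin n →₀ ℕ)
    (x : ι →₀ MvPolynomial (Fin n) k) : Prop :=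
  ∀ a, x a ≠ 0 → ∃ (e : Fin n →₀ ℕ) (c : k), x a = MvPolynomial.monomial e c ∧ e + deg a = μ

/-- Setting all the variables equal to `1`. -/
noncomputable def dehomogenize {ι : Type v} (x : ι →₀ MvPolynomial (Fin n) k) : ι →₀ k :=
  mapRange (MvPolynomial.eval (fun _ : Fin n => (1 : k))) (map_zero _) x

end Multigraded

/-- A complex of multigraded free modules over `S = k[x₁, …, xₙ]` with a fixed multigraded
basis; the basis element `b` has multidegree `x ^ deg b`. -/
structure MultigradedComplex (k : Type u) [Field k] (n : ℕ) extends
    BasedComplex.{u, v} (MvPolynomial (Fin n) k) where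
  deg : ∀ i, ι i → (Fin n →₀ ℕ)
  homogeneous : ∀ i (b : ι (i + 1)), IsMultigraded (deg i) (deg (i + 1) b) (d i (single b 1))

namespace MultigradedComplex

variable {k : Type u} [Field k] {n : ℕ}

/-- Multigraded isomorphisms of complexes of multigraded free modules. -/
structure Iso (F : MultigradedComplex.{u, v} k n) (G : MultigradedComplex.{u, w} k n) where
  equiv : ∀ i, (F.ι i →₀ MvPolynomial (Fin n) k) ≃ₗ[MvPolynomial (Fin n) k]
    (G.ι i →₀ MvPolynomial (Fin n) k)
  comm : ∀ i x, equiv i (F.d i x) = G.d i (equiv (i + 1) x)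
  homogeneous : ∀ i b, IsMultigraded (G.deg i) (F.deg i b) (equiv i (single b 1))

/-- The direct sum of two complexes, with the union of the two bases as its basis. -/
noncomputable def directSum (F : MultigradedComplex.{u, v} k n)
    (G : MultigradedComplex.{u, w} k n) : MultigradedComplex.{u, max v w} k n where
  ι i := F.ι i ⊕ G.ι i
  finite := by
    have := F.finite
    have := G.finite
    exact Finite.of_injective
      (fun x : (Σ i, F.ι i ⊕ G.ι i) =>
        (x.2.elim (fun a => Sum.inl ⟨x.1, a⟩) (fun a => Sum.inr ⟨x.1, a⟩) :
          (Σ i, F.ι i) ⊕ (Σ i, G.ι i))) (by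
        rintro ⟨i, a | a⟩ ⟨j, b | b⟩ h
        · simp only [Sum.elim_inl, Sum.inl.injEq, Sigma.mk.injEq] at h
          obtain ⟨rfl, h⟩ := h
          simp_all
        · simp at h
        · simp at h
        · simp only [Sum.elim_inr, Sum.inr.injEq, Sigma.mk.injEq] at h
          obtain ⟨rfl, h⟩ := h
          simp_all)
  d i := (sumFinsuppLEquivProdFinsupp (MvPolynomial (Fin n) k)).symm.toLinearMap ∘ₗ
    (F.d i).prodMap (G.d i) ∘ₗ
      (sumFinsuppLEquivProdFinsupp (MvPolynomial (Fin n) k)).toLinearMap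
  d_comp_d i := by
    have hF := fun x => LinearMap.congr_fun (F.d_comp_d i) x
    have hG := fun x => LinearMap.congr_fun (G.d_comp_d i) x
    simp only [LinearMap.comp_apply, LinearMap.zero_apply] at hF hG
    apply LinearMap.ext
    intro x
    simp only [LinearMap.comp_apply, LinearEquiv.coe_coe, LinearEquiv.apply_symm_apply,
      LinearMap.prodMap_apply, hF, hG, LinearMap.zero_apply]
    exact map_zero _
  deg i := Sum.elim (F.deg i) (G.deg i)
  homogeneous i b := by
    rcases b with b | b
    · have h : sumFinsuppLEquivProdFinsupp (MvPolynomial (Fin n) k)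
          (single (Sum.inl b : F.ι (i + 1) ⊕ G.ι (i + 1)) (1 : MvPolynomial (Fin n) k))
          = (single b 1, 0) := by
        ext c <;> simp [sumFinsuppLEquivProdFinsupp]
      rintro (a | a) ha
      · simp only [LinearMap.comp_apply, LinearEquiv.coe_coe, h] at ha ⊢
        simp only [LinearMap.prodMap_apply, map_zero,
          sumFinsuppLEquivProdFinsupp_symm_inl] at ha ⊢
        exact F.homogeneous i b a ha
      · simp [LinearMap.comp_apply, h] at ha
    · have h : sumFinsuppLEquivProdFinsupp (MvPolynomial (Fin n) k)
          (single (Sum.inr b : F.ι (i + 1) ⊕ G.ι (i + 1)) (1 : MvPolynomial (Fin n) k))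
          = (0, single b 1) := by
        ext c <;> simp [sumFinsuppLEquivProdFinsupp]
      rintro (a | a) ha
      · simp [LinearMap.comp_apply, h] at ha
      · simp only [LinearMap.comp_apply, LinearEquiv.coe_coe, h] at ha ⊢
        simp only [LinearMap.prodMap_apply, map_zero,
          sumFinsuppLEquivProdFinsupp_symm_inr] at ha ⊢
        exact G.homogeneous i b a ha

/-- A trivial complex: a direct sum of short trivial complexes
`0 → S(-m) → S(-m) → 0` (with the identity map). The set `top i` consists of the basis
elements in degree `i` that are the source of one of these, and `π` maps the source to the
target. -/
def IsTrivial (E : MultigradedComplex.{u, v} k n) : Prop :=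
  ∃ (top : ∀ i, Set (E.ι i)) (π : ∀ i, top (i + 1) ≃ ((top i)ᶜ : Set (E.ι i))),
    top 0 = ∅ ∧
    (∀ i (b : top (i + 1)), E.d i (single b.1 1) = single (π i b).1 1) ∧
    ∀ i (b : E.ι (i + 1)), b ∉ top (i + 1) → E.d i (single b 1) = 0

/-- `F` is a multigraded free resolution of `S / M`: exact in positive homological degrees, with
a multigraded augmentation `ε` that identifies the cokernel of `F₁ → F₀` with `S / M`. -/
def IsFreeResolution (F : MultigradedComplex.{u, v} k n)
    (M : Ideal (MvPolynomial (Fin n) k)) : Prop :=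
  (∀ i, Function.Exact (F.d (i + 1)) (F.d i)) ∧
  ∃ ε : (F.ι 0 →₀ MvPolynomial (Fin n) k) →ₗ[MvPolynomial (Fin n) k]
      (MvPolynomial (Fin n) k ⧸ M),
    Function.Surjective ε ∧ Function.Exact (F.d 0) ε ∧
    ∀ b, ∃ c : k, ε (single b 1) = Ideal.Quotient.mk M (MvPolynomial.monomial (F.deg 0 b) c)

/-- Minimal free resolutions: all the entries of the differentials lie in `(x₁, …, xₙ)`. -/
def IsMinimalFreeResolution (F : MultigradedComplex.{u, v} k n)
    (M : Ideal (MvPolynomial (Fin n) k)) : Prop :=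
  F.IsFreeResolution M ∧
  ∀ i (b : F.ι (i + 1)) (a : F.ι i),
    F.d i (single b 1) a ∈ Ideal.span (Set.range (MvPolynomial.X : Fin n → MvPolynomial (Fin n) k))

/-- The subcomplex spanned by the basis elements whose multidegree lies in a divisor-closed
set of monomials. -/
noncomputable def restrictDeg (F : MultigradedComplex.{u, v} k n) (s : LowerSet (Fin n →₀ ℕ)) :
    MultigradedComplex.{u, v} k n where
  toBasedComplex := F.toBasedComplex.restrict (fun i b => F.deg i b ∈ s) (by
    intro i b hb a ha
    obtain ⟨e, c, -, h⟩ := F.homogeneous i b a ha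
    exact s.lower (by rw [← h]; exact le_add_self) hb)
  deg i b := F.deg i b.1
  homogeneous i := by
    rintro ⟨b, hb⟩ ⟨a, ha⟩ h
    rw [BasedComplex.restrict_d_single] at h ⊢
    exact F.homogeneous i b a h

/-- The subcomplex `F(≤ m)` spanned by the basis elements whose multidegree divides `x ^ μ`. -/
noncomputable def le (F : MultigradedComplex.{u, v} k n) (μ : Fin n →₀ ℕ) :
    MultigradedComplex.{u, v} k n :=
  F.restrictDeg (LowerSet.Iic μ)

/-- The subcomplex `F(< m)` spanned by the basis elements whose multidegree strictly divides
`x ^ μ`. -/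
noncomputable def lt (F : MultigradedComplex.{u, v} k n) (μ : Fin n →₀ ℕ) :
    MultigradedComplex.{u, v} k n :=
  F.restrictDeg (LowerSet.Iio μ)

/-- The frame of a multigraded complex: the complex of `k`-vector spaces with the same basis
obtained by setting all the variables equal to `1`. -/
noncomputable def frame (F : MultigradedComplex.{u, v} k n) : BasedComplex.{u, v} k where
  ι := F.ι
  finite := F.finite
  d i := linearCombination k (fun b => dehomogenize (F.d i (single b 1)))
  d_comp_d i := by
    have add : ∀ {ι : Type v} (x y : ι →₀ MvPolynomial (Fin n) k),
        dehomogenize (x + y) = dehomogenize x + dehomogenize y := by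
      intro ι x y; ext a; simp [dehomogenize]
    have smul : ∀ {ι : Type v} (c : MvPolynomial (Fin n) k) (x : ι →₀ MvPolynomial (Fin n) k),
        dehomogenize (c • x) = MvPolynomial.eval (fun _ => (1 : k)) c • dehomogenize x := by
      intro ι c x; ext a; simp [dehomogenize]
    have key : ∀ x : F.ι (i + 1) →₀ MvPolynomial (Fin n) k,
        linearCombination k (fun b => dehomogenize (F.d i (single b 1))) (dehomogenize x)
          = dehomogenize (F.d i x) := by
      intro x
      induction x using Finsupp.induction_linear with
      | zero => simp [dehomogenize]
      | add x y hx hy => rw [add, map_add, map_add, add, hx, hy]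
      | single b c =>
        have h : (single b c : F.ι (i + 1) →₀ MvPolynomial (Fin n) k) = c • single b 1 := by
          simp
        rw [h, map_smul, smul, smul, map_smul]
        congr 1
        simp [dehomogenize]
    apply Finsupp.lhom_ext'
    intro b
    apply LinearMap.ext_ring
    have h2 := LinearMap.congr_fun (F.d_comp_d i) (single b 1)
    simp only [LinearMap.comp_apply, LinearMap.zero_apply] at h2
    simp only [LinearMap.comp_apply, lsingle_apply, linearCombination_single, one_smul, key, h2,
      LinearMap.zero_apply]
    simp [dehomogenize]

end MultigradedComplex

/-! ### Chains in the simplex and the Taylor resolution -/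

/-- The faces with `i` elements of the simplex on the vertices `1, …, r`. -/
abbrev Face (r i : ℕ) : Type := {A : Finset (Fin r) // A.card = i}

/-- The chains over `k` in homological degree `i`: linear combinations of faces with `i`
elements (that is, of dimension `i - 1`; the empty face is in degree `0`). -/
abbrev Chain (k : Type u) [Field k] (r i : ℕ) : Type u := Face r i →₀ k

section Boundary

variable {R : Type u} [CommRing R] {r : ℕ}

/-- The face obtained by removing a vertex. -/
def Face.erase {i : ℕ} (A : Face r (i + 1)) (j : A.1) : Face r i :=
  ⟨A.1.erase j.1, by rw [Finset.card_erase_of_mem j.2, A.2]; rfl⟩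

/-- The sign `(-1) ^ p`, where `p` is the number of elements of `A` before `j`. -/
def faceSign (A : Finset (Fin r)) (j : Fin r) : ℤ := (-1) ^ (A.filter (· < j)).card

/-- The boundary map `A ↦ ∑ j ∈ A, ± w(A, A \ j) (A \ j)` with weights `w`. -/
noncomputable def weightedBoundary (wt : Finset (Fin r) → Finset (Fin r) → R) (i : ℕ) :
    (Face r (i + 1) →₀ R) →ₗ[R] (Face r i →₀ R) :=
  linearCombination R fun A =>
    ∑ j : A.1, single (A.erase j) ((faceSign A.1 j.1 : R) * wt A.1 (A.erase j).1)

theorem faceSign_comm (A : Finset (Fin r)) {j l : Fin r} (hj : j ∈ A) (hl : l ∈ A)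
    (h : j ≠ l) :
    faceSign A j * faceSign (A.erase j) l = -(faceSign A l * faceSign (A.erase l) j) := by
  wlog hlt : j < l generalizing j l
  · rw [this hl hj h.symm (lt_of_le_of_ne (not_lt.mp hlt) h.symm), neg_neg]
  have h1 : (A.erase l).filter (· < j) = A.filter (· < j) := by
    ext a
    simp only [Finset.mem_filter, Finset.mem_erase]
    constructor
    · rintro ⟨⟨-, h⟩, h'⟩; exact ⟨h, h'⟩
    · rintro ⟨h, h'⟩; exact ⟨⟨(h'.trans hlt).ne, h⟩, h'⟩
  have h2 : (A.erase j).filter (· < l) = (A.filter (· < l)).erase j := by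
    ext a
    simp only [Finset.mem_filter, Finset.mem_erase]
    tauto
  have hmem : j ∈ A.filter (· < l) := by simp [hj, hlt]
  have h3 := Finset.card_erase_add_one hmem
  unfold faceSign
  rw [h1, h2, ← h3, pow_succ]
  ring

theorem weightedBoundary_comp (wt : Finset (Fin r) → Finset (Fin r) → R)
    (wt' : Finset (Fin r) → Finset (Fin r) → R)
    (hwt : ∀ A B C, C ⊆ B → B ⊆ A → wt A B * wt B C = wt' A C) (i : ℕ) :
    weightedBoundary wt i ∘ₗ weightedBoundary wt (i + 1) = 0 := by
  apply Finsupp.lhom_ext'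
  intro A
  apply LinearMap.ext_ring
  simp only [LinearMap.comp_apply, lsingle_apply, LinearMap.zero_apply]
  have e1 : weightedBoundary wt (i + 1) (single A 1) =
      ∑ j : A.1, single (A.erase j) ((faceSign A.1 j.1 : R) * wt A.1 (A.erase j).1) := by
    simp [weightedBoundary]
  rw [e1, map_sum]
  have e2 : ∀ j : A.1, weightedBoundary wt i
      (single (A.erase j) ((faceSign A.1 j.1 : R) * wt A.1 (A.erase j).1)) =
      ∑ l : (A.erase j).1, single ((A.erase j).erase l)
        (((faceSign A.1 j.1 * faceSign (A.erase j).1 l.1 : ℤ) : R) *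
          wt' A.1 ((A.erase j).erase l).1) := by
    intro j
    simp only [weightedBoundary, linearCombination_single, Finset.smul_sum, smul_single,
      smul_eq_mul]
    refine Finset.sum_congr rfl fun l _ => ?_
    congr 1
    rw [← hwt A.1 (A.erase j).1 ((A.erase j).erase l).1 (Finset.erase_subset _ _)
      (Finset.erase_subset _ _)]
    push_cast
    ring
  simp only [e2]
  rw [← Fintype.sum_sigma
    (fun x : (Σ j : A.1, (A.erase j).1) => single ((A.erase x.1).erase x.2)
        (((faceSign A.1 x.1.1 * faceSign (A.erase x.1).1 x.2.1 : ℤ) : R) *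
          wt' A.1 ((A.erase x.1).erase x.2).1))]
  have hmem : ∀ x : (Σ j : A.1, (A.erase j).1), x.2.1 ∈ A.1 ∧ x.2.1 ≠ x.1.1 := by
    intro x
    have := x.2.2
    simp only [Face.erase, Finset.mem_erase] at this
    exact ⟨this.2, this.1⟩
  refine Finset.sum_involution
    (fun x _ => (⟨⟨x.2.1, (hmem x).1⟩, ⟨x.1.1, by
      simp only [Face.erase, Finset.mem_erase]
      exact ⟨(hmem x).2.symm, x.1.2⟩⟩⟩ : Σ j : A.1, (A.erase j).1)) ?_ ?_ ?_ ?_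
  · intro x _
    have hface : (A.erase ⟨x.2.1, (hmem x).1⟩).erase ⟨x.1.1, by
      simp only [Face.erase, Finset.mem_erase]
      exact ⟨(hmem x).2.symm, x.1.2⟩⟩ = (A.erase x.1).erase x.2 := by
      apply Subtype.ext
      simp only [Face.erase]
      exact Finset.erase_right_comm
    rw [hface, ← single_add, ← add_mul, ← Int.cast_add]
    have := faceSign_comm A.1 x.1.2 (hmem x).1 (hmem x).2.symm
    simp only [Face.erase]
    rw [this]
    simp
  · intro x _ _ h
    have h1 : x.2.1 = x.1.1 := congrArg (fun y : (Σ j : A.1, (A.erase j).1) => y.1.1) h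
    exact (hmem x).2 h1
  · intro x _; exact Finset.mem_univ _
  · intro x _; rfl

end Boundary

section Chains

variable {k : Type u} [Field k] {n r : ℕ}

/-- The (augmented) boundary map of the simplex, from degree `i + 1` to degree `i`. -/
noncomputable def boundary (k : Type u) [Field k] (r i : ℕ) :
    Chain k r (i + 1) →ₗ[k] Chain k r i :=
  weightedBoundary (fun _ _ => 1) i

theorem boundary_comp (i : ℕ) : boundary k r i ∘ₗ boundary k r (i + 1) = 0 :=
  weightedBoundary_comp _ (fun _ _ => 1) (by simp) i

/-- The support of a chain: the union of the faces that occur in it. -/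
noncomputable def Chain.vertices {i : ℕ} (c : Chain k r i) : Finset (Fin r) :=
  c.support.sup fun A => A.1

/-- The exponent of the multidegree of a chain: the least common multiple of the multidegrees
`lcm (m_i | i ∈ A)` of the faces `A` that occur in it. -/
noncomputable def Chain.mdeg (m : Fin r → (Fin n →₀ ℕ)) {i : ℕ} (c : Chain k r i) :
    Fin n →₀ ℕ :=
  c.support.sup fun A => A.1.sup m

/-- The Taylor resolution of the ideal generated by the monomials `x ^ m i`. -/
noncomputable def taylorComplex (k : Type u) [Field k] (m : Fin r → (Fin n →₀ ℕ)) :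
    MultigradedComplex.{u, 0} k n where
  ι i := Face r i
  finite := Finite.of_injective (fun x : (Σ i, Face r i) => x.2.1) (by
    rintro ⟨i, A, rfl⟩ ⟨j, B, rfl⟩ h
    simp only at h
    subst h
    rfl)
  d i := weightedBoundary (fun A B => MvPolynomial.monomial (A.sup m - B.sup m) 1) i
  d_comp_d i := by
    refine weightedBoundary_comp _
      (fun A C => MvPolynomial.monomial (A.sup m - C.sup m) 1) ?_ i
    intro A B C hCB hBA
    rw [MvPolynomial.monomial_mul, one_mul,
      tsub_add_tsub_cancel (Finset.sup_mono hBA) (Finset.sup_mono hCB)]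
  deg i A := A.1.sup m
  homogeneous i A := by
    intro B hB
    simp only [weightedBoundary, linearCombination_single, one_smul, Finsupp.finsetSum_apply,
      single_apply] at hB ⊢
    obtain ⟨j, -, hj⟩ := Finset.exists_ne_zero_of_sum_ne_zero hB
    have hjB : A.erase j = B := by
      by_contra h
      simp [h] at hj
    rw [Finset.sum_eq_single j]
    · rw [if_pos hjB]
      refine ⟨A.1.sup m - B.1.sup m, (faceSign A.1 j.1 : k), ?_, ?_⟩
      · rw [hjB, ← map_intCast (MvPolynomial.C : k →+* MvPolynomial (Fin n) k),
          MvPolynomial.C_mul_monomial, mul_one]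
      · rw [← hjB]
        exact tsub_add_cancel_of_le (Finset.sup_mono (Finset.erase_subset _ _))
    · intro l _ hl
      rw [if_neg]
      intro h
      apply hl
      have h' : A.1.erase l.1 = A.1.erase j.1 := congrArg Subtype.val (h.trans hjB.symm)
      exact Subtype.ext ((Finset.erase_inj A.1 l.2).1 h')
    · intro h; exact absurd (Finset.mem_univ j) h

/-- `B` is a Taylor basis of `F`: there are a trivial complex `E` and a multigraded isomorphism
from `F ⊕ E` to the Taylor resolution `T` (equivalently, a change of basis of `T` after which `T`
is equal to `F ⊕ E`), and `B` consists of the dehomogenizations of the elements of `T` that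
correspond to the basis elements of `F`. -/
def IsTaylorBasis (m : Fin r → (Fin n →₀ ℕ)) (F : MultigradedComplex.{u, v} k n)
    (B : ∀ i, F.ι i → Chain k r i) : Prop :=
  ∃ (E : MultigradedComplex.{u, 0} k n) (φ : (F.directSum E).Iso (taylorComplex k m)),
    E.IsTrivial ∧
    ∀ i (b : F.ι i),
      B i b = dehomogenize (φ.equiv i (single (Sum.inl b : F.ι i ⊕ E.ι i) 1))

/-- A set of chains is linearly independent, and the boundary of each of its elements is a linear
combination of its elements. -/
structure BoundaryStable (X : ∀ i, Set (Chain k r i)) : Prop where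
  indep : ∀ i, LinearIndependent k (Subtype.val : X i → Chain k r i)
  stable : ∀ i, ∀ x ∈ X (i + 1), boundary k r i x ∈ Submodule.span k (X i)

/-- The complex of `k`-vector spaces with basis `X` obtained by applying the boundary map of the
simplex to the chains in `X`. -/
noncomputable def chainComplex (X : ∀ i, Set (Chain k r i)) (h : BoundaryStable X) :
    BasedComplex.{u, u} k where
  ι i := X i
  finite := by
    have hfin : ∀ i, Finite (X i) := fun i => (h.indep i).finite
    have hle : ∀ x : (Σ i, X i), x.1 < r + 1 := by
      rintro ⟨i, x⟩
      by_contra hi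
      have hempty : IsEmpty (Face r i) := ⟨fun A => by
        have h1 := Finset.card_le_univ A.1
        rw [A.2, Fintype.card_fin] at h1
        simp only at hi
        omega⟩
      exact (h.indep i).ne_zero x (Subsingleton.elim _ _)
    exact Finite.of_injective
      (fun x : (Σ i, X i) => (⟨⟨x.1, hle x⟩, x.2⟩ : Σ i : Fin (r + 1), X i)) (by
        rintro ⟨i, x⟩ ⟨j, y⟩ hxy
        simp only [Sigma.mk.injEq, Fin.mk.injEq] at hxy
        obtain ⟨rfl, hxy⟩ := hxy
        simp_all)
  d i := linearCombination k fun x : X (i + 1) =>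
    (h.indep i).repr ⟨boundary k r i x.1, by
      rw [Subtype.range_coe]; exact h.stable i x.1 x.2⟩
  d_comp_d i := by
    have key : ∀ j (x : X (j + 1) →₀ k),
        linearCombination k (Subtype.val : X j → Chain k r j)
          (linearCombination k (fun x : X (j + 1) =>
            (h.indep j).repr ⟨boundary k r j x.1, by
              rw [Subtype.range_coe]; exact h.stable j x.1 x.2⟩) x)
        = boundary k r j (linearCombination k (Subtype.val : X (j + 1) → Chain k r (j + 1)) x) := by
      intro j x
      induction x using Finsupp.induction_linear with
      | zero => simp
      | add x y hx hy => simp only [map_add, hx, hy]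
      | single b c =>
        simp only [linearCombination_single, map_smul]
        rw [(h.indep j).linearCombination_repr]
    apply LinearMap.ext
    intro x
    apply h.indep i
    simp only [LinearMap.comp_apply, LinearMap.zero_apply, map_zero]
    rw [key i, key (i + 1)]
    exact LinearMap.congr_fun (boundary_comp i) _

end Chains

/-! ### The construction of Taylor bases from an atomic lattice -/

section Lattice

variable {k : Type u} [Field k] {r : ℕ} {L : Type w} [PartialOrder L]

/-- The union of the sets `Γ β` for `β ≤ α`. -/
def upTo (Γ : L → ∀ i, Set (Chain k r i)) (α : L) (i : ℕ) : Set (Chain k r i) :=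
  ⋃ β ≤ α, Γ β i

/-- The union of the sets `Γ β` for `β < α`. -/
def below (Γ : L → ∀ i, Set (Chain k r i)) (α : L) (i : ℕ) : Set (Chain k r i) :=
  ⋃ β < α, Γ β i

/-- The inductive step of the construction at `α`. The chains in `⋃ β < α, Γ β` form a complex
`U`; an exact closure `V` of `U` is chosen; and every basis element `f` of `V` that does not
belong to `U` is replaced by a chain `ρ f` of the same homological degree, supported on the
atoms below `α`, whose boundary is the value of the differential of `V` at `f`. The set `Γ α`
consists of these chains `ρ f`. -/
def IsTaylorStep (atom : Fin r → L) (Γ : L → ∀ i, Set (Chain k r i)) (α : L) : Prop :=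
  ∃ (hU : BoundaryStable (below Γ α)) (V : BasedComplex.{u, u} k)
    (j : BasedComplex.Sub (chainComplex (below Γ α) hU) V) (ρ : ∀ i, V.ι i → Chain k r i),
    j.IsExactClosure ∧
    (∀ i (x : below Γ α i), ρ i (j.emb i x) = x.1) ∧
    (∀ i, Set.BijOn (ρ i) (Set.range (j.emb i))ᶜ (Γ α i)) ∧
    (∀ i, ∀ f ∉ Set.range (j.emb i), ∀ l ∈ (ρ i f).vertices, atom l ≤ α) ∧
    ∀ i, ∀ f ∉ Set.range (j.emb (i + 1)),
      boundary k r i (ρ (i + 1) f) = linearCombination k (ρ i) (V.d i (single f 1))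

/-- The sets `Γ α`, for `α` in an atomic lattice with the atoms `atom 1, …, atom r`, are a
possible outcome of the inductive construction of Taylor basis elements. -/
structure IsTaylorConstruction [OrderBot L] (atom : Fin r → L)
    (Γ : L → ∀ i, Set (Chain k r i)) : Prop where
  bot : ∃ c : k, c ≠ 0 ∧ Γ ⊥ 0 = {single ⟨∅, rfl⟩ c} ∧ ∀ i, Γ ⊥ (i + 1) = ∅
  atoms : ∀ j, ∃ c : k, c ≠ 0 ∧ Γ (atom j) 0 = ∅ ∧
    Γ (atom j) 1 = {single ⟨{j}, Finset.card_singleton j⟩ c} ∧ ∀ i, Γ (atom j) (i + 2) = ∅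
  step : ∀ α, α ≠ ⊥ → α ∉ Set.range atom → IsTaylorStep atom Γ α

end Lattice

/-! ### Monomial ideals, lcm-lattices and atomic lattice resolutions -/

section Monomial

variable {k : Type u} [Field k] {n r : ℕ}

/-- The ideal `M` is minimally generated by the monomials `x ^ m 1, …, x ^ m r`. -/
def IsMinimallyGeneratedBy (M : Ideal (MvPolynomial (Fin n) k)) (m : Fin r → (Fin n →₀ ℕ)) :
    Prop :=
  M = Ideal.span (Set.range fun i => MvPolynomial.monomial (m i) (1 : k)) ∧
  ∀ j, MvPolynomial.monomial (m j) (1 : k) ∉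
    Ideal.span ((fun i => MvPolynomial.monomial (m i) (1 : k)) '' {j}ᶜ)

/-- The lcm-lattice: the least common multiples of subsets of the generators (given by their
exponents), ordered by divisibility. -/
abbrev LcmLattice (m : Fin r → (Fin n →₀ ℕ)) : Type :=
  {μ : Fin n →₀ ℕ // ∃ A : Finset (Fin r), A.sup m = μ}

instance LcmLattice.orderBot (m : Fin r → (Fin n →₀ ℕ)) : OrderBot (LcmLattice m) where
  bot := ⟨0, ∅, rfl⟩
  bot_le x := show (0 : Fin n →₀ ℕ) ≤ x.1 from zero_le

noncomputable instance LcmLattice.orderTop (m : Fin r → (Fin n →₀ ℕ)) : OrderTop (LcmLattice m) where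
  top := ⟨Finset.univ.sup m, Finset.univ, rfl⟩
  le_top x := by
    obtain ⟨μ, A, rfl⟩ := x
    exact Finset.sup_mono (f := m) (Finset.subset_univ A)

/-- The atoms of the lcm-lattice. -/
def LcmLattice.atom (m : Fin r → (Fin n →₀ ℕ)) (j : Fin r) : LcmLattice m :=
  ⟨m j, {j}, Finset.sup_singleton⟩

/-- `F` is equal (as a complex with a fixed basis) to the `M`-homogenization of the frame `U`,
where `U` is one-dimensional in degree `0`, its basis in degree `1` is labelled by the generators
of `M` via `ℓ`, and its differential in degree `1` does not vanish at any basis element. The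
multidegree is `1` in degree `0`, the generator `m_j` at the basis element with label `j` in
degree `1`, and the lcm of the multidegrees of the basis elements occurring in the differential
in higher degrees. -/
def IsHomogenization (m : Fin r → (Fin n →₀ ℕ)) (U : BasedComplex.{u, w} k)
    (ℓ : U.ι 1 ≃ Fin r) (F : MultigradedComplex.{u, v} k n) : Prop :=
  (∃ a : U.ι 0, (∀ a', a' = a) ∧ ∀ b, U.d 0 (single b 1) a ≠ 0) ∧
  ∃ e : ∀ i, F.ι i ≃ U.ι i,
    (∀ a, F.deg 0 a = 0) ∧
    (∀ b, F.deg 1 b = m (ℓ (e 1 b))) ∧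
    (∀ i b, F.deg (i + 2) b =
      (U.d (i + 1) (single (e (i + 2) b) 1)).support.sup
        fun a => F.deg (i + 1) ((e (i + 1)).symm a)) ∧
    ∀ i b a, F.d i (single b 1) a =
      MvPolynomial.monomial (F.deg (i + 1) b - F.deg i a)
        (U.d i (single (e (i + 1) b) 1) (e i a))

/-- `F` is an atomic lattice resolution: it is the `M`-homogenization of the frame at the top
element obtained from the lcm-lattice of `M` by the construction of Taylor basis elements. -/
def IsAtomicLatticeResolution (m : Fin r → (Fin n →₀ ℕ)) (F : MultigradedComplex.{u, v} k n) :
    Prop :=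
  ∃ (Γ : LcmLattice m → ∀ i, Set (Chain k r i)) (h : BoundaryStable (upTo Γ ⊤))
    (ℓ : upTo Γ ⊤ 1 ≃ Fin r),
    IsTaylorConstruction (LcmLattice.atom m) Γ ∧
    (∀ j, (ℓ.symm j).1 ∈ Γ (LcmLattice.atom m j) 1) ∧
    IsHomogenization m (chainComplex (upTo Γ ⊤) h) ℓ F

/-- The elements of `B` of multidegree `μ`. -/
def elementsOfDegree (m : Fin r → (Fin n →₀ ℕ)) {F : MultigradedComplex.{u, v} k n}
    (B : ∀ i, F.ι i → Chain k r i) (μ : LcmLattice m) (i : ℕ) : Set (Chain k r i) :=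
  {f | f ∈ Set.range (B i) ∧ f.mdeg m = μ.1}

end Monomial

/-! ### Setting the variables equal to one -/

section Dehomogenization

variable {k : Type u} [Field k] {n : ℕ} {ι : Type v} {κ : Type w}

/-! Setting the variables to 1 in the isomorphism of F ⊕ E with the Taylor resolution turns the
frame of F into a direct summand of the augmented chain complex of the simplex. The inclusion sends
basis elements to the chains B. The inclusion and the projection both respect the filtration by
multidegree, because a multigraded isomorphism and its inverse are both multigraded. This is
recorded in `FrameRetraction`.

Fix ν divisible by some generator m_j. The faces whose lcm divides ν form a full simplex, and the
cone with apex j contracts it. A retract of an exact complex is exact, so the frame of F(≤ ν) is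
exact (`exists_d_zero_eq`, `exists_d_succ_eq`). Minimality says that a nonzero entry of the frame
differential strictly raises multidegree, so the differential of the frame of F(≤ ν) takes values in
the frame of F(< ν).

An exact complex V containing U with d(V) ⊆ U is an exact closure of U
(`Sub.isExactClosure_of_d_mem_range`). Given another exact W containing U, send each basis element
of V outside U to an element of W with the same boundary. The resulting map is injective, since an
element of its kernel is a cycle, hence a boundary, hence lies in U, where the map is the given
inclusion. So the frame of F(≤ m) is an admissible choice at each step, and the new basis elements
are already chains.

For the homogenization the multidegrees must be recovered from the frame. If the lcm ν of the terms
of d(b) were smaller than deg b, exactness over ν would give y with d(y) = d(b) not involving b.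
Then b − y would be a cycle, hence a boundary, below deg b, and minimality forbids a boundary there
from containing b (`d_ne_d_single`). -/

theorem dehomogenize_apply (x : ι →₀ MvPolynomial (Fin n) k) (a : ι) :
    dehomogenize x a = MvPolynomial.eval (fun _ : Fin n => (1 : k)) (x a) := by
  simp [dehomogenize]

theorem dehomogenize_zero : dehomogenize (0 : ι →₀ MvPolynomial (Fin n) k) = 0 := by
  simp [dehomogenize]

theorem dehomogenize_add (x y : ι →₀ MvPolynomial (Fin n) k) :
    dehomogenize (x + y) = dehomogenize x + dehomogenize y := by
  ext a; simp [dehomogenize]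

theorem dehomogenize_smul (c : MvPolynomial (Fin n) k) (x : ι →₀ MvPolynomial (Fin n) k) :
    dehomogenize (c • x) = MvPolynomial.eval (fun _ => (1 : k)) c • dehomogenize x := by
  ext a; simp [dehomogenize]

theorem dehomogenize_single (b : ι) :
    dehomogenize (single b (1 : MvPolynomial (Fin n) k)) = single b 1 := by
  simp [dehomogenize]

/-- The `k`-linear map obtained from a map of free modules by setting the variables equal
to `1` in its matrix. -/
noncomputable def dehomogenizeMap
    (f : (ι →₀ MvPolynomial (Fin n) k) →ₗ[MvPolynomial (Fin n) k]
      (κ →₀ MvPolynomial (Fin n) k)) : (ι →₀ k) →ₗ[k] (κ →₀ k) :=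
  linearCombination k fun b => dehomogenize (f (single b 1))

theorem dehomogenizeMap_single
    (f : (ι →₀ MvPolynomial (Fin n) k) →ₗ[MvPolynomial (Fin n) k]
      (κ →₀ MvPolynomial (Fin n) k)) (b : ι) :
    dehomogenizeMap f (single b 1) = dehomogenize (f (single b 1)) := by
  simp [dehomogenizeMap]

theorem dehomogenizeMap_dehomogenize
    (f : (ι →₀ MvPolynomial (Fin n) k) →ₗ[MvPolynomial (Fin n) k]
      (κ →₀ MvPolynomial (Fin n) k)) (x : ι →₀ MvPolynomial (Fin n) k) :
    dehomogenizeMap f (dehomogenize x) = dehomogenize (f x) := by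
  induction x using Finsupp.induction_linear with
  | zero => simp [dehomogenize_zero]
  | add x y hx hy => rw [dehomogenize_add, map_add, map_add, dehomogenize_add, hx, hy]
  | single b c =>
    have h : (single b c : ι →₀ MvPolynomial (Fin n) k) = c • single b 1 := by simp
    rw [h, map_smul, dehomogenize_smul, dehomogenize_smul, map_smul, dehomogenize_single,
      dehomogenizeMap_single]

theorem dehomogenizeMap_comp_apply {τ : Type*}
    (f : (ι →₀ MvPolynomial (Fin n) k) →ₗ[MvPolynomial (Fin n) k]
      (κ →₀ MvPolynomial (Fin n) k))
    (g : (κ →₀ MvPolynomial (Fin n) k) →ₗ[MvPolynomial (Fin n) k]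
      (τ →₀ MvPolynomial (Fin n) k)) (x : ι →₀ k) :
    dehomogenizeMap (g ∘ₗ f) x = dehomogenizeMap g (dehomogenizeMap f x) := by
  suffices h : dehomogenizeMap (g ∘ₗ f) = dehomogenizeMap g ∘ₗ dehomogenizeMap f from
    LinearMap.congr_fun h x
  apply Finsupp.lhom_ext'
  intro b
  apply LinearMap.ext_ring
  simp [dehomogenizeMap_single, dehomogenizeMap_dehomogenize]

theorem dehomogenizeMap_id :
    dehomogenizeMap (LinearMap.id : (ι →₀ MvPolynomial (Fin n) k) →ₗ[MvPolynomial (Fin n) k] _)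
      = LinearMap.id := by
  apply Finsupp.lhom_ext'
  intro b
  apply LinearMap.ext_ring
  simp [dehomogenizeMap_single, dehomogenize_single]

/-- The isomorphism of vector spaces obtained by setting the variables equal to `1` in an
isomorphism of free modules. -/
noncomputable def dehomogenizeEquiv
    (f : (ι →₀ MvPolynomial (Fin n) k) ≃ₗ[MvPolynomial (Fin n) k]
      (κ →₀ MvPolynomial (Fin n) k)) : (ι →₀ k) ≃ₗ[k] (κ →₀ k) :=
  LinearEquiv.ofLinearMap (dehomogenizeMap f.toLinearMap) (dehomogenizeMap f.symm.toLinearMap)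
    (by
      ext1 x; ext1
      simp only [LinearMap.comp_apply, ← dehomogenizeMap_comp_apply]
      simp [dehomogenizeMap_id])
    (by
      ext1 x; ext1
      simp only [LinearMap.comp_apply, ← dehomogenizeMap_comp_apply]
      simp [dehomogenizeMap_id])

open Classical in
/-- The coefficients of the component of multidegree `x ^ μ` of an element of the multigraded
free module whose basis element `b` has multidegree `x ^ deg b`. -/
noncomputable def componentCoeff (deg : ι → (Fin n →₀ ℕ)) (μ : Fin n →₀ ℕ)
    (x : ι →₀ MvPolynomial (Fin n) k) : ι →₀ k :=
  onFinset x.support (fun b => if deg b ≤ μ then (x b).coeff (μ - deg b) else 0) (by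
    intro b hb
    rw [mem_support_iff]
    rintro h
    simp [h] at hb)

open Classical in
theorem componentCoeff_apply (deg : ι → (Fin n →₀ ℕ)) (μ : Fin n →₀ ℕ)
    (x : ι →₀ MvPolynomial (Fin n) k) (b : ι) :
    componentCoeff deg μ x b = if deg b ≤ μ then (x b).coeff (μ - deg b) else 0 := rfl

theorem deg_le_of_componentCoeff_ne_zero {deg : ι → (Fin n →₀ ℕ)} {μ : Fin n →₀ ℕ}
    {x : ι →₀ MvPolynomial (Fin n) k} {b : ι} (h : componentCoeff deg μ x b ≠ 0) :
    deg b ≤ μ := by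
  by_contra hb
  simp [componentCoeff_apply, hb] at h

theorem componentCoeff_zero (deg : ι → (Fin n →₀ ℕ)) (μ : Fin n →₀ ℕ) :
    componentCoeff deg μ (0 : ι →₀ MvPolynomial (Fin n) k) = 0 := by
  ext b; simp [componentCoeff_apply]

theorem componentCoeff_add (deg : ι → (Fin n →₀ ℕ)) (μ : Fin n →₀ ℕ)
    (x y : ι →₀ MvPolynomial (Fin n) k) :
    componentCoeff deg μ (x + y) = componentCoeff deg μ x + componentCoeff deg μ y := by
  ext b
  simp only [componentCoeff_apply, Finsupp.add_apply, MvPolynomial.coeff_add]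
  split_ifs <;> simp

open Classical in
-- A monomial multiple of a multigraded element lives in a single multidegree, and there its
-- coefficients are what remains at x = 1. By additivity this determines all components.
theorem componentCoeff_monomial_smul (deg : ι → (Fin n →₀ ℕ)) (μ ν e : Fin n →₀ ℕ) (c : k)
    {x : ι →₀ MvPolynomial (Fin n) k} (hx : IsMultigraded deg ν x) :
    componentCoeff deg μ (MvPolynomial.monomial e c • x)
      = if e + ν = μ then c • dehomogenize x else 0 := by
  ext b
  rw [componentCoeff_apply]
  by_cases hb : x b = 0
  · have : (if e + ν = μ then c • dehomogenize x else 0) b = 0 := by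
      split_ifs <;> simp [dehomogenize_apply, hb]
    rw [this]
    simp [hb]
  · obtain ⟨e', c', h, rfl⟩ := hx b hb
    rw [Finsupp.smul_apply, h, smul_eq_mul, MvPolynomial.monomial_mul, MvPolynomial.coeff_monomial]
    by_cases hμ : e + (e' + deg b) = μ
    · subst hμ
      rw [if_pos, if_pos, if_pos rfl, Finsupp.smul_apply, dehomogenize_apply, h,
        MvPolynomial.eval_monomial]
      · simp
      · rw [← add_assoc, add_tsub_cancel_right]
      · rw [← add_assoc]; exact le_add_self
    · rw [if_neg hμ]
      split_ifs with h1 h2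
      · exact absurd (by rw [← add_assoc, h2, tsub_add_cancel_of_le h1]) hμ
      · simp
      · simp

theorem isMultigraded_single (deg : ι → (Fin n →₀ ℕ)) (b : ι) :
    IsMultigraded deg (deg b) (single b (1 : MvPolynomial (Fin n) k)) := by
  intro a ha
  by_cases h : b = a
  · subst h
    exact ⟨0, 1, by simp, by simp⟩
  · simp [h] at ha

/-- On each multigraded component a multigraded map acts by one and the same scalar matrix, namely
its matrix at x = 1. This gives control of an inverse map that is not assumed multigraded. -/
theorem componentCoeff_map {degι : ι → (Fin n →₀ ℕ)} {degκ : κ → (Fin n →₀ ℕ)}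
    (f : (ι →₀ MvPolynomial (Fin n) k) →ₗ[MvPolynomial (Fin n) k]
      (κ →₀ MvPolynomial (Fin n) k))
    (hf : ∀ b, IsMultigraded degκ (degι b) (f (single b 1))) (μ : Fin n →₀ ℕ)
    (x : ι →₀ MvPolynomial (Fin n) k) :
    componentCoeff degκ μ (f x) = dehomogenizeMap f (componentCoeff degι μ x) := by
  classical
  induction x using Finsupp.induction_linear with
  | zero => simp [componentCoeff_zero]
  | add x y hx hy => rw [map_add, componentCoeff_add, componentCoeff_add, map_add, hx, hy]
  | single b p =>
    induction p using MvPolynomial.induction_on' with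
    | add p q hp hq =>
      rw [single_add, map_add, componentCoeff_add, componentCoeff_add, map_add, hp, hq]
    | monomial e c =>
      have h : (single b (MvPolynomial.monomial e c) : ι →₀ MvPolynomial (Fin n) k)
          = MvPolynomial.monomial e c • single b 1 := by simp
      rw [h, map_smul, componentCoeff_monomial_smul degκ μ _ e c (hf b),
        componentCoeff_monomial_smul degι μ _ e c (isMultigraded_single degι b)]
      split_ifs
      · rw [map_smul, dehomogenize_single, dehomogenizeMap_single]
      · simp

theorem deg_le_of_dehomogenize_ne_zero {deg : ι → (Fin n →₀ ℕ)} {ν : Fin n →₀ ℕ}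
    {x : ι →₀ MvPolynomial (Fin n) k} (hx : IsMultigraded deg ν x) {a : ι}
    (ha : dehomogenize x a ≠ 0) : deg a ≤ ν := by
  obtain ⟨e, c, -, rfl⟩ := hx a (fun h => ha (by simp [dehomogenize_apply, h]))
  exact le_add_self

/-- The inverse of a multigraded isomorphism is multigraded. -/
theorem deg_le_of_dehomogenizeEquiv_symm_ne_zero {degι : ι → (Fin n →₀ ℕ)}
    {degκ : κ → (Fin n →₀ ℕ)}
    (f : (ι →₀ MvPolynomial (Fin n) k) ≃ₗ[MvPolynomial (Fin n) k]
      (κ →₀ MvPolynomial (Fin n) k))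
    (hf : ∀ b, IsMultigraded degκ (degι b) (f (single b 1))) (a : κ) (b : ι)
    (h : (dehomogenizeEquiv f).symm (single a 1) b ≠ 0) : degι b ≤ degκ a := by
  -- The component of multidegree `degκ a` of the preimage of `a` is mapped to `a` at x = 1, so by
  -- injectivity it is the dehomogenized preimage. A component involves only basis elements of
  -- smaller or equal multidegree.
  have h1 := componentCoeff_map f.toLinearMap hf (degκ a) (f.symm (single a 1))
  have h2 : componentCoeff degκ (degκ a) (single a (1 : MvPolynomial (Fin n) k)) = single a 1 := by
    have := componentCoeff_monomial_smul degκ (degκ a) _ 0 1 (isMultigraded_single (k := k) degκ a)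
    simpa [dehomogenize_single] using this
  have h3 : dehomogenizeEquiv f (componentCoeff degι (degκ a) (f.symm (single a 1)))
      = single a 1 := by
    rw [← h2]
    have h4 := h1.symm
    simp only [LinearEquiv.coe_coe, LinearEquiv.apply_symm_apply] at h4
    exact h4
  rw [← h3, LinearEquiv.symm_apply_apply] at h
  exact deg_le_of_componentCoeff_ne_zero h

end Dehomogenization

/-! ### Exactness of the simplex -/

section Cone

variable {k : Type u} [Field k] {r : ℕ}

/-- The face obtained by adding a vertex. -/
def Face.insert {i : ℕ} (A : Face r i) (j : Fin r) (hj : j ∉ A.1) : Face r (i + 1) :=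
  ⟨Insert.insert j A.1, by rw [Finset.card_insert_of_notMem hj, A.2]⟩

/-- The contracting homotopy of the simplex given by the cone with apex `j`. -/
noncomputable def cone (k : Type u) [Field k] {r : ℕ} (j : Fin r) (i : ℕ) :
    Chain k r i →ₗ[k] Chain k r (i + 1) :=
  linearCombination k fun A =>
    if hj : j ∈ A.1 then 0
    else single (A.insert j hj) ((faceSign (Insert.insert j A.1) j : ℤ) : k)

theorem faceSign_mul_self (A : Finset (Fin r)) (j : Fin r) : faceSign A j * faceSign A j = 1 := by
  unfold faceSign
  rw [← mul_pow]
  simp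

theorem boundary_single {i : ℕ} (A : Face r (i + 1)) :
    boundary k r i (single A 1) = ∑ j : A.1, single (A.erase j) ((faceSign A.1 j.1 : ℤ) : k) := by
  simp [boundary, weightedBoundary]

theorem cone_single_of_mem {i : ℕ} {A : Face r i} {j : Fin r} (hj : j ∈ A.1) :
    cone k j i (single A 1) = 0 := by
  simp [cone, hj]

theorem cone_single_of_notMem {i : ℕ} {A : Face r i} {j : Fin r} (hj : j ∉ A.1) :
    cone k j i (single A 1)
      = single (A.insert j hj) ((faceSign (Insert.insert j A.1) j : ℤ) : k) := by
  simp [cone, hj]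

theorem boundary_single_smul {i : ℕ} (A : Face r (i + 1)) (c : k) :
    boundary k r i (single A c) = c • boundary k r i (single A 1) := by
  rw [← map_smul]; simp

theorem cone_single_smul {i : ℕ} (j : Fin r) (A : Face r i) (c : k) :
    cone k j i (single A c) = c • cone k j i (single A 1) := by
  rw [← map_smul]; simp

/-- Isolates the face opposite the apex: it yields the identity in the homotopy formula, while the
remaining faces still contain `j` and must cancel. -/
theorem boundary_insert {i : ℕ} (A : Face r i) (j : Fin r) (hj : j ∉ A.1) :
    boundary k r i (single (A.insert j hj) 1) =
      single A ((faceSign (Insert.insert j A.1) j : ℤ) : k) +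
      ∑ l : A.1, single ((A.insert j hj).erase ⟨l.1, Finset.mem_insert_of_mem l.2⟩)
        ((faceSign (Insert.insert j A.1) l.1 : ℤ) : k) := by
  rw [boundary_single]
  have hj' : j ∈ (A.insert j hj).1 := Finset.mem_insert_self _ _
  rw [← Finset.add_sum_erase _ _ (Finset.mem_univ (⟨j, hj'⟩ : (A.insert j hj).1))]
  congr 1
  · congr 1
    exact Subtype.ext (Finset.erase_insert hj)
  · symm
    refine Finset.sum_bij (fun l _ => ⟨l.1, Finset.mem_insert_of_mem l.2⟩) ?_ ?_ ?_ ?_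
    · intro l _
      simp only [Finset.mem_erase, Finset.mem_univ, and_true, ne_eq]
      intro h
      have hlj : l.1 = j := Subtype.ext_iff.1 h
      exact hj (hlj ▸ l.2)
    · intro a _ b _ h
      have hab : a.1 = b.1 := congrArg (fun x : (A.insert j hj).1 => x.1) h
      exact Subtype.ext hab
    · rintro ⟨l, hl⟩ h
      have hlj : l ≠ j := fun h' => (Finset.mem_erase.1 h).1 (Subtype.ext h')
      exact ⟨⟨l, (Finset.mem_insert.1 hl).resolve_left hlj⟩, Finset.mem_univ _, rfl⟩
    · intro l _; rfl

/-- Nothing lies below the empty face, so the homotopy formula has only one term here. It gives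
exactness in degree 0 of the augmented complex. -/
theorem boundary_cone_zero (j : Fin r) (x : Chain k r 0) :
    boundary k r 0 (cone k j 0 x) = x := by
  suffices h : boundary k r 0 ∘ₗ cone k j 0 = LinearMap.id from LinearMap.congr_fun h x
  apply Finsupp.lhom_ext'
  intro A
  apply LinearMap.ext_ring
  have hA : A.1 = ∅ := Finset.card_eq_zero.1 A.2
  have hj : j ∉ A.1 := by simp [hA]
  have : IsEmpty A.1 := by rw [hA]; infer_instance
  simp only [LinearMap.comp_apply, lsingle_apply, LinearMap.id_apply]
  rw [cone_single_of_notMem hj, boundary_single_smul, boundary_insert, Finset.univ_eq_empty,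
    Finset.sum_empty, add_zero, smul_single, smul_eq_mul, ← Int.cast_mul, faceSign_mul_self,
    Int.cast_one]

/-- For a face containing `j`, only the cone over the face without `j` survives, and it restores the
original face. For a face without `j`, removing `l` and adding `j` commute up to sign, so every term
but the one opposite the apex cancels. -/
theorem boundary_cone_add (j : Fin r) (i : ℕ) (x : Chain k r (i + 1)) :
    boundary k r (i + 1) (cone k j (i + 1) x) + cone k j i (boundary k r i x) = x := by
  suffices h : boundary k r (i + 1) ∘ₗ cone k j (i + 1) + cone k j i ∘ₗ boundary k r i
      = LinearMap.id from LinearMap.congr_fun h x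
  apply Finsupp.lhom_ext'
  intro A
  apply LinearMap.ext_ring
  simp only [LinearMap.comp_apply, lsingle_apply, LinearMap.id_apply, LinearMap.add_apply]
  by_cases hj : j ∈ A.1
  · rw [cone_single_of_mem hj, map_zero, zero_add, boundary_single, map_sum,
      Finset.sum_eq_single ⟨j, hj⟩]
    · have hj' : j ∉ (A.erase ⟨j, hj⟩).1 := Finset.notMem_erase _ _
      have hA : (A.erase ⟨j, hj⟩).insert j hj' = A := Subtype.ext (Finset.insert_erase hj)
      rw [cone_single_smul, cone_single_of_notMem hj', hA]
      have hA' : Insert.insert j (A.erase ⟨j, hj⟩).1 = A.1 := Finset.insert_erase hj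
      rw [hA', smul_single, smul_eq_mul, ← Int.cast_mul, faceSign_mul_self, Int.cast_one]
    · intro l _ hl
      rw [cone_single_smul, cone_single_of_mem, smul_zero]
      exact Finset.mem_erase.2 ⟨fun h => hl (Subtype.ext h.symm), hj⟩
    · intro h; exact absurd (Finset.mem_univ _) h
  · rw [cone_single_of_notMem hj, boundary_single_smul, boundary_insert, smul_add, smul_single,
      smul_eq_mul, ← Int.cast_mul, faceSign_mul_self, Int.cast_one, add_assoc,
      add_eq_left, boundary_single, map_sum, Finset.smul_sum, ← Finset.sum_add_distrib]
    refine Finset.sum_eq_zero fun l _ => ?_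
    have hlj : l.1 ≠ j := fun h => hj (h ▸ l.2)
    have hj' : j ∉ (A.erase l).1 := fun h => hj (Finset.mem_of_mem_erase h)
    have hf : (A.erase l).insert j hj'
        = (A.insert j hj).erase ⟨l.1, Finset.mem_insert_of_mem l.2⟩ :=
      Subtype.ext (Finset.erase_insert_of_ne hlj.symm).symm
    have hf' : Insert.insert j (A.erase l).1 = (Insert.insert j A.1).erase l.1 :=
      (Finset.erase_insert_of_ne hlj.symm).symm
    rw [cone_single_smul, cone_single_of_notMem hj', hf, hf', smul_single, smul_single,
      smul_eq_mul, smul_eq_mul, ← single_add, ← Int.cast_mul, ← Int.cast_mul, ← Int.cast_add]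
    have hs := faceSign_comm (Insert.insert j A.1) (Finset.mem_insert_self j A.1)
      (Finset.mem_insert_of_mem l.2) hlj.symm
    rw [Finset.erase_insert hj] at hs
    have h1 := faceSign_mul_self A.1 l.1
    have h2 := faceSign_mul_self (Insert.insert j A.1) l.1
    -- Multiply `hs` by the two signs attached to `l`; signs square to 1.
    have h3 : faceSign (Insert.insert j A.1) j * faceSign (Insert.insert j A.1) l.1
        + faceSign A.1 l.1 * faceSign ((Insert.insert j A.1).erase l.1) j = 0 := by
      linear_combination faceSign (Insert.insert j A.1) l.1 * faceSign A.1 l.1 * hs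
        - faceSign (Insert.insert j A.1) j * faceSign (Insert.insert j A.1) l.1 * h1
        - faceSign A.1 l.1 * faceSign ((Insert.insert j A.1).erase l.1) j * h2
    rw [h3]; simp

end Cone

/-! ### The frame of a resolution as a retract of the simplex -/

section Retraction

variable {k : Type u} [Field k] {n r : ℕ}

theorem map_mem_of_mem_supported {ι : Type v} {N : Type w} [AddCommGroup N] [Module k N]
    (f : (ι →₀ k) →ₗ[k] N) {s : Set ι} {Q : Submodule k N} (h : ∀ b ∈ s, f (single b 1) ∈ Q)
    {x : ι →₀ k} (hx : x ∈ supported k k s) : f x ∈ Q := by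
  rw [supported_eq_span_single] at hx
  have h1 : Submodule.span k ((fun i => single i (1 : k)) '' s) ≤ Q.comap f := by
    rw [Submodule.span_le]
    rintro _ ⟨b, hb, rfl⟩
    exact h b hb
  exact h1 hx

section SumMap

variable {R : Type u} [CommRing R] {ι : Type v} {ι' : Type v} {κ : Type w} {κ' : Type w}

/-- The direct sum of two maps between free modules. -/
noncomputable def finsuppSumMap (f : (ι →₀ R) →ₗ[R] (ι' →₀ R)) (g : (κ →₀ R) →ₗ[R] (κ' →₀ R)) :
    (ι ⊕ κ →₀ R) →ₗ[R] (ι' ⊕ κ' →₀ R) :=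
  (sumFinsuppLEquivProdFinsupp R).symm.toLinearMap ∘ₗ f.prodMap g ∘ₗ
    (sumFinsuppLEquivProdFinsupp R).toLinearMap

variable (f : (ι →₀ R) →ₗ[R] (ι' →₀ R)) (g : (κ →₀ R) →ₗ[R] (κ' →₀ R))

theorem finsuppSumMap_single_inl (b : ι) :
    finsuppSumMap f g (single (Sum.inl b) 1) = mapDomain Sum.inl (f (single b 1)) := by
  have h : sumFinsuppLEquivProdFinsupp R (single (Sum.inl b : ι ⊕ κ) (1 : R))
      = (single b 1, 0) := by
    ext c <;> simp [sumFinsuppLEquivProdFinsupp]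
  ext a
  rcases a with a | a
  · rw [mapDomain_apply Sum.inl_injective]
    simp [finsuppSumMap, h]
  · rw [mapDomain_of_notMem_range _ _ (by simp)]
    simp [finsuppSumMap, h]

/-- The first projection from a direct sum of free modules. -/
noncomputable def finsuppSumFst (R : Type u) [CommRing R] (ι : Type v) (κ : Type w) :
    (ι ⊕ κ →₀ R) →ₗ[R] (ι →₀ R) :=
  lcomapDomain Sum.inl Sum.inl_injective

theorem finsuppSumFst_apply (x : ι ⊕ κ →₀ R) (a : ι) :
    finsuppSumFst R ι κ x a = x (Sum.inl a) := rfl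

theorem finsuppSumFst_single_inl (b : ι) :
    finsuppSumFst R ι κ (single (Sum.inl b) 1) = single b 1 := by
  classical
  ext a
  simp [finsuppSumFst_apply, single_apply]

theorem finsuppSumFst_single_inr (b : κ) :
    finsuppSumFst R ι κ (single (Sum.inr b) 1) = 0 := by
  ext a
  simp [finsuppSumFst_apply]

theorem finsuppSumMap_apply_inl (x : ι ⊕ κ →₀ R) (a : ι') :
    finsuppSumMap f g x (Sum.inl a) = f (finsuppSumFst R ι κ x) a := by
  have h : (sumFinsuppLEquivProdFinsupp R x).1 = finsuppSumFst R ι κ x := by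
    ext c
    simp [sumFinsuppLEquivProdFinsupp, finsuppSumFst_apply]
  rw [← h]
  simp [finsuppSumMap]

end SumMap

theorem dehomogenize_mapDomain {ι : Type v} {κ : Type w} {f : ι → κ} (hf : Function.Injective f)
    (x : ι →₀ MvPolynomial (Fin n) k) :
    dehomogenize (mapDomain f x) = mapDomain f (dehomogenize x) := by
  ext a
  by_cases ha : a ∈ Set.range f
  · obtain ⟨b, rfl⟩ := ha
    rw [dehomogenize_apply, mapDomain_apply hf, mapDomain_apply hf, dehomogenize_apply]
  · rw [dehomogenize_apply, mapDomain_of_notMem_range _ _ ha, mapDomain_of_notMem_range _ _ ha,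
      map_zero]

/-- Setting the variables equal to `1` in the Taylor resolution gives the simplex. -/
theorem dehomogenizeMap_weightedBoundary (wt : Finset (Fin r) → Finset (Fin r) → (Fin n →₀ ℕ))
    (i : ℕ) :
    dehomogenizeMap (weightedBoundary
      (fun A C => MvPolynomial.monomial (wt A C) (1 : k)) i) = boundary k r i := by
  classical
  apply Finsupp.lhom_ext'
  intro A
  apply LinearMap.ext_ring
  simp only [LinearMap.comp_apply, lsingle_apply, dehomogenizeMap_single]
  ext C
  rw [dehomogenize_apply]
  simp only [boundary, weightedBoundary, linearCombination_single, one_smul,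
    Finsupp.finsetSum_apply, single_apply, map_sum]
  refine Finset.sum_congr rfl fun j _ => ?_
  split_ifs <;> simp [MvPolynomial.eval_monomial]

/-- A multidegree-preserving presentation of the frame of `F` as a direct summand of the simplex,
the basis elements of `F` being sent to the chains `B`. -/
structure FrameRetraction (m : Fin r → (Fin n →₀ ℕ)) (F : MultigradedComplex.{u, v} k n)
    (B : ∀ i, F.ι i → Chain k r i) where
  retr : ∀ i, Chain k r i →ₗ[k] (F.ι i →₀ k)
  retr_basis : ∀ i b, retr i (B i b) = single b 1
  boundary_basis : ∀ i b, boundary k r i (B (i + 1) b)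
    = linearCombination k (B i) (dehomogenizeMap (F.d i) (single b 1))
  retr_boundary : ∀ i x, retr i (boundary k r i x) = dehomogenizeMap (F.d i) (retr (i + 1) x)
  deg_basis : ∀ i b A, B i b A ≠ 0 → A.1.sup m ≤ F.deg i b
  deg_retr : ∀ i A b, retr i (single A 1) b ≠ 0 → F.deg i b ≤ A.1.sup m

theorem dehomogenizeMap_finsuppSumMap_inl {ι ι' : Type v} {κ κ' : Type w}
    (f : (ι →₀ MvPolynomial (Fin n) k) →ₗ[MvPolynomial (Fin n) k]
      (ι' →₀ MvPolynomial (Fin n) k))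
    (g : (κ →₀ MvPolynomial (Fin n) k) →ₗ[MvPolynomial (Fin n) k]
      (κ' →₀ MvPolynomial (Fin n) k)) (b : ι) :
    dehomogenizeMap (finsuppSumMap f g) (single (Sum.inl b) 1)
      = mapDomain Sum.inl (dehomogenizeMap f (single b 1)) := by
  rw [dehomogenizeMap_single, dehomogenizeMap_single, finsuppSumMap_single_inl,
    dehomogenize_mapDomain Sum.inl_injective]

theorem finsuppSumFst_dehomogenizeMap_finsuppSumMap {ι ι' : Type v} {κ κ' : Type w}
    (f : (ι →₀ MvPolynomial (Fin n) k) →ₗ[MvPolynomial (Fin n) k]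
      (ι' →₀ MvPolynomial (Fin n) k))
    (g : (κ →₀ MvPolynomial (Fin n) k) →ₗ[MvPolynomial (Fin n) k]
      (κ' →₀ MvPolynomial (Fin n) k)) (x : ι ⊕ κ →₀ k) :
    finsuppSumFst k ι' κ' (dehomogenizeMap (finsuppSumMap f g) x)
      = dehomogenizeMap f (finsuppSumFst k ι κ x) := by
  suffices h : finsuppSumFst k ι' κ' ∘ₗ dehomogenizeMap (finsuppSumMap f g)
      = dehomogenizeMap f ∘ₗ finsuppSumFst k ι κ from LinearMap.congr_fun h x
  apply Finsupp.lhom_ext'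
  intro b
  apply LinearMap.ext_ring
  simp only [LinearMap.comp_apply, lsingle_apply]
  ext a
  rw [finsuppSumFst_apply, dehomogenizeMap_single, dehomogenize_apply, finsuppSumMap_apply_inl]
  rcases b with b | b
  · rw [finsuppSumFst_single_inl, finsuppSumFst_single_inl, dehomogenizeMap_single,
      dehomogenize_apply]
  · rw [finsuppSumFst_single_inr, finsuppSumFst_single_inr]
    simp

/-- The retraction is the inverse isomorphism at x = 1 followed by the projection onto the first
summand. The isomorphism enters as a bare family `e` so that the differential of the sum can be
written as `finsuppSumMap`. -/
theorem nonempty_frameRetraction_of_equiv {m : Fin r → (Fin n →₀ ℕ)}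
    {F : MultigradedComplex.{u, v} k n} {B : ∀ i, F.ι i → Chain k r i}
    (E : MultigradedComplex.{u, w} k n)
    (e : ∀ i, (F.ι i ⊕ E.ι i →₀ MvPolynomial (Fin n) k) ≃ₗ[MvPolynomial (Fin n) k]
      (Face r i →₀ MvPolynomial (Fin n) k))
    (hcomm : ∀ i x, e i (finsuppSumMap (F.d i) (E.d i) x) =
      weightedBoundary (fun A C => MvPolynomial.monomial (A.sup m - C.sup m) 1) i (e (i + 1) x))
    (hhom : ∀ i b, IsMultigraded (fun A : Face r i => A.1.sup m)
      (Sum.elim (F.deg i) (E.deg i) b) (e i (single b 1)))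
    (hB : ∀ i b, B i b = dehomogenize (e i (single (Sum.inl b) 1))) :
    Nonempty (FrameRetraction m F B) := by
  have hcomm' : ∀ i x, dehomogenizeEquiv (e i)
      (dehomogenizeMap (finsuppSumMap (F.d i) (E.d i)) x)
      = boundary k r i (dehomogenizeEquiv (e (i + 1)) x) := by
    intro i x
    rw [← dehomogenizeMap_weightedBoundary (fun A C => A.sup m - C.sup m) i]
    have h : (e i).toLinearMap ∘ₗ finsuppSumMap (F.d i) (E.d i)
        = weightedBoundary (fun A C => MvPolynomial.monomial (A.sup m - C.sup m) 1) i ∘ₗ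
          (e (i + 1)).toLinearMap :=
      LinearMap.ext fun x => hcomm i x
    have h1 := dehomogenizeMap_comp_apply (finsuppSumMap (F.d i) (E.d i)) (e i).toLinearMap x
    rw [h, dehomogenizeMap_comp_apply] at h1
    exact h1.symm
  have hB' : ∀ i b, B i b = dehomogenizeEquiv (e i) (single (Sum.inl b) 1) := by
    intro i b
    rw [hB i b]
    exact (dehomogenizeMap_single (e i).toLinearMap _).symm
  have hlin : ∀ i x, linearCombination k (B i) x
      = dehomogenizeEquiv (e i) (mapDomain Sum.inl x) := by
    intro i x
    suffices h : linearCombination k (B i)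
        = (dehomogenizeEquiv (e i)).toLinearMap ∘ₗ lmapDomain k k Sum.inl from
      LinearMap.congr_fun h x
    apply Finsupp.lhom_ext'
    intro b
    apply LinearMap.ext_ring
    simp [hB']
  refine ⟨⟨fun i => finsuppSumFst k (F.ι i) (E.ι i) ∘ₗ
    (dehomogenizeEquiv (e i)).symm.toLinearMap, ?_, ?_, ?_, ?_, ?_⟩⟩
  · intro i b
    simp only [LinearMap.comp_apply, LinearEquiv.coe_coe]
    rw [hB', LinearEquiv.symm_apply_apply, finsuppSumFst_single_inl]
  · intro i b
    rw [hlin, ← dehomogenizeMap_finsuppSumMap_inl (F.d i) (E.d i), hcomm', ← hB']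
  · intro i x
    simp only [LinearMap.comp_apply, LinearEquiv.coe_coe]
    rw [← finsuppSumFst_dehomogenizeMap_finsuppSumMap (F.d i) (E.d i)]
    congr 1
    rw [LinearEquiv.symm_apply_eq, hcomm', LinearEquiv.apply_symm_apply]
  · intro i b A hA
    rw [hB i b] at hA
    exact deg_le_of_dehomogenize_ne_zero (hhom i (Sum.inl b)) hA
  · intro i A b hb
    exact deg_le_of_dehomogenizeEquiv_symm_ne_zero (e i) (hhom i) A (Sum.inl b) hb

theorem IsTaylorBasis.nonempty_frameRetraction {m : Fin r → (Fin n →₀ ℕ)}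
    {F : MultigradedComplex.{u, v} k n} {B : ∀ i, F.ι i → Chain k r i}
    (hB : IsTaylorBasis m F B) : Nonempty (FrameRetraction m F B) := by
  obtain ⟨E, φ, -, hB⟩ := hB
  -- The differential of `directSum` unfolds to `finsuppSumMap`, so the fields of `φ` apply as they
  -- stand.
  exact nonempty_frameRetraction_of_equiv E φ.equiv φ.comm φ.homogeneous hB

end Retraction

/-! ### First consequences of the retraction: independence and multidegrees -/

namespace FrameRetraction

variable {k : Type u} [Field k] {n r : ℕ} {m : Fin r → (Fin n →₀ ℕ)}
  {F : MultigradedComplex.{u, v} k n} {B : ∀ i, F.ι i → Chain k r i}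

theorem retr_linearCombination (R : FrameRetraction m F B) (i : ℕ) (x : F.ι i →₀ k) :
    R.retr i (linearCombination k (B i) x) = x := by
  suffices h : R.retr i ∘ₗ linearCombination k (B i) = LinearMap.id from LinearMap.congr_fun h x
  apply Finsupp.lhom_ext'
  intro b
  apply LinearMap.ext_ring
  simp [R.retr_basis]

theorem linearIndependent (R : FrameRetraction m F B) (i : ℕ) : LinearIndependent k (B i) :=
  Function.LeftInverse.injective (R.retr_linearCombination i)

theorem injective (R : FrameRetraction m F B) (i : ℕ) : Function.Injective (B i) :=
  (R.linearIndependent i).injective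

theorem boundary_linearCombination (R : FrameRetraction m F B) (i : ℕ) (x : F.ι (i + 1) →₀ k) :
    boundary k r i (linearCombination k (B (i + 1)) x)
      = linearCombination k (B i) (dehomogenizeMap (F.d i) x) := by
  suffices h : boundary k r i ∘ₗ linearCombination k (B (i + 1))
      = linearCombination k (B i) ∘ₗ dehomogenizeMap (F.d i) from LinearMap.congr_fun h x
  apply Finsupp.lhom_ext'
  intro b
  apply LinearMap.ext_ring
  simp only [LinearMap.comp_apply, lsingle_apply, linearCombination_single, one_smul]
  exact R.boundary_basis i b

theorem linearCombination_mem_supported (R : FrameRetraction m F B) {i : ℕ} {ν : Fin n →₀ ℕ}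
    {x : F.ι i →₀ k} (hx : x ∈ supported k k {b | F.deg i b ≤ ν}) :
    linearCombination k (B i) x ∈ supported k k {A : Face r i | A.1.sup m ≤ ν} := by
  refine map_mem_of_mem_supported _ ?_ hx
  intro b hb A hA
  rw [linearCombination_single, one_smul] at hA
  exact (R.deg_basis i b A (mem_support_iff.1 hA)).trans hb

theorem retr_mem_supported (R : FrameRetraction m F B) {i : ℕ} {ν : Fin n →₀ ℕ}
    {y : Chain k r i} (hy : y ∈ supported k k {A : Face r i | A.1.sup m ≤ ν}) :
    R.retr i y ∈ supported k k {b | F.deg i b ≤ ν} := by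
  refine map_mem_of_mem_supported _ ?_ hy
  intro A hA b hb
  exact (R.deg_retr i A b (mem_support_iff.1 hb)).trans hA

/-- The multidegree of a basis element is the multidegree of the corresponding chain. -/
theorem mdeg_basis (R : FrameRetraction m F B) (i : ℕ) (b : F.ι i) :
    (B i b).mdeg m = F.deg i b := by
  apply le_antisymm
  · exact Finset.sup_le fun A hA => R.deg_basis i b A (mem_support_iff.1 hA)
  -- The retraction does not raise multidegree and returns `b` from its chain, so `b` has
  -- multidegree at most that of the chain.
  · have h : B i b ∈ supported k k {A : Face r i | A.1.sup m ≤ (B i b).mdeg m} := by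
      intro A hA
      exact Finset.le_sup (f := fun A : Face r i => A.1.sup m) hA
    have h1 := R.retr_mem_supported h
    rw [R.retr_basis] at h1
    exact h1 (by simp)

/-- Ensures that the sets indexed by the lcm-lattice exhaust the basis. The witness is the set of
all vertices of the chain. -/
theorem deg_mem_lcmLattice (R : FrameRetraction m F B) (i : ℕ) (b : F.ι i) :
    ∃ A : Finset (Fin r), A.sup m = F.deg i b := by
  refine ⟨(B i b).vertices, ?_⟩
  rw [← R.mdeg_basis, Chain.vertices, Finset.sup_eq_biUnion, Finset.sup_biUnion]
  rfl

end FrameRetraction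

/-- Adjoining a vertex whose generator divides x^ν keeps the lcm a divisor of x^ν, so the
contraction restricts to the subcomplex below ν. -/
theorem cone_mem_supported {k : Type u} [Field k] {n r : ℕ} {m : Fin r → (Fin n →₀ ℕ)} {i : ℕ}
    {ν : Fin n →₀ ℕ} {j : Fin r} (hj : m j ≤ ν) {y : Chain k r i}
    (hy : y ∈ supported k k {A : Face r i | A.1.sup m ≤ ν}) :
    cone k j i y ∈ supported k k {A : Face r (i + 1) | A.1.sup m ≤ ν} := by
  refine map_mem_of_mem_supported _ ?_ hy
  intro A hA
  by_cases hjA : j ∈ A.1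
  · rw [cone_single_of_mem hjA]
    exact zero_mem _
  · rw [cone_single_of_notMem hjA]
    refine single_mem_supported k _ ?_
    change (Insert.insert j A.1).sup m ≤ ν
    rw [Finset.sup_insert]
    exact sup_le hj hA

/-! ### Exactness of the frames of the subcomplexes F(≤ m) -/

namespace FrameRetraction

variable {k : Type u} [Field k] {n r : ℕ} {m : Fin r → (Fin n →₀ ℕ)}
  {F : MultigradedComplex.{u, v} k n} {B : ∀ i, F.ι i → Chain k r i}

/-- Include into the simplex, cone off, project back: each of the three maps preserves the
filtration, so the primitive stays below ν. -/
theorem exists_d_eq_of_boundary_cone (R : FrameRetraction m F B) {ν : Fin n →₀ ℕ} {j : Fin r}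
    (hj : m j ≤ ν) {i : ℕ} {x : F.ι i →₀ k} (hx : x ∈ supported k k {b | F.deg i b ≤ ν})
    (h : boundary k r i (cone k j i (linearCombination k (B i) x))
      = linearCombination k (B i) x) :
    ∃ z ∈ supported k k {b | F.deg (i + 1) b ≤ ν}, dehomogenizeMap (F.d i) z = x := by
  refine ⟨R.retr (i + 1) (cone k j i (linearCombination k (B i) x)),
    R.retr_mem_supported (cone_mem_supported hj (R.linearCombination_mem_supported hx)), ?_⟩
  rw [← R.retr_boundary, h, R.retr_linearCombination]

/-- The frame of `F(≤ m)` is exact in degree `0` if `m` is divisible by a generator. -/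
theorem exists_d_zero_eq (R : FrameRetraction m F B) {ν : Fin n →₀ ℕ} {j : Fin r}
    (hj : m j ≤ ν) {x : F.ι 0 →₀ k} (hx : x ∈ supported k k {b | F.deg 0 b ≤ ν}) :
    ∃ z ∈ supported k k {b | F.deg 1 b ≤ ν}, dehomogenizeMap (F.d 0) z = x :=
  R.exists_d_eq_of_boundary_cone hj hx (boundary_cone_zero j _)

/-- The frame of `F(≤ m)` is exact in positive degrees if `m` is divisible by a generator. -/
theorem exists_d_succ_eq (R : FrameRetraction m F B) {ν : Fin n →₀ ℕ} {j : Fin r}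
    (hj : m j ≤ ν) {i : ℕ} {x : F.ι (i + 1) →₀ k}
    (hx : x ∈ supported k k {b | F.deg (i + 1) b ≤ ν}) (h0 : dehomogenizeMap (F.d i) x = 0) :
    ∃ z ∈ supported k k {b | F.deg (i + 2) b ≤ ν}, dehomogenizeMap (F.d (i + 1)) z = x := by
  refine R.exists_d_eq_of_boundary_cone hj hx ?_
  have h := boundary_cone_add j i (linearCombination k (B (i + 1)) x)
  rwa [R.boundary_linearCombination, h0, map_zero, map_zero, add_zero] at h

end FrameRetraction

/-! ### Minimality and multidegrees -/

namespace MultigradedComplex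

variable {k : Type u} [Field k] {n : ℕ} {F : MultigradedComplex.{u, v} k n}
  {M : Ideal (MvPolynomial (Fin n) k)}

/-- The entries of the differentials of a minimal resolution strictly increase multidegrees. -/
theorem IsMinimalFreeResolution.deg_lt (hF : F.IsMinimalFreeResolution M) {i : ℕ}
    {b : F.ι (i + 1)} {a : F.ι i} (h : dehomogenizeMap (F.d i) (single b 1) a ≠ 0) :
    F.deg i a < F.deg (i + 1) b := by
  rw [dehomogenizeMap_single] at h
  have h0 : F.d i (single b 1) a ≠ 0 := fun h' => h (by simp [dehomogenize_apply, h'])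
  obtain ⟨e, c, he, hdeg⟩ := F.homogeneous i b a h0
  have hmem := hF.2 i b a
  rw [he] at hmem h0
  rw [← hdeg]
  -- Equal multidegrees would make the entry a nonzero constant, but the ideal of the variables lies
  -- in the kernel of `constantCoeff`.
  refine lt_of_le_of_ne le_add_self ?_
  intro heq
  have he0 : e = 0 := by
    have : 0 + F.deg i a = e + F.deg i a := by rw [zero_add]; exact heq
    exact (add_right_cancel this).symm
  subst he0
  have h1 : Ideal.span (Set.range (MvPolynomial.X : Fin n → MvPolynomial (Fin n) k))
      ≤ RingHom.ker (MvPolynomial.constantCoeff : MvPolynomial (Fin n) k →+* k) := by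
    rw [Ideal.span_le]
    rintro _ ⟨j, rfl⟩
    simp [RingHom.mem_ker]
  have h2 := h1 hmem
  rw [RingHom.mem_ker, MvPolynomial.constantCoeff_monomial, if_pos rfl] at h2
  exact h0 (by simp [h2])

/-- The criterion for exact closures rests on this: differentials of the complex at `μ` already lie
in the complex strictly below `μ`. -/
theorem IsMinimalFreeResolution.d_mem_supported (hF : F.IsMinimalFreeResolution M) {i : ℕ}
    {μ : Fin n →₀ ℕ} {x : F.ι (i + 1) →₀ k} (hx : x ∈ supported k k {b | F.deg (i + 1) b ≤ μ}) :
    dehomogenizeMap (F.d i) x ∈ supported k k {a | F.deg i a < μ} := by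
  refine map_mem_of_mem_supported _ ?_ hx
  intro b hb a ha
  exact (hF.deg_lt (mem_support_iff.1 ha)).trans_le hb

end MultigradedComplex

/-! ### Minimality of exact closures -/

namespace BasedComplex

section Rank

universe v₁ v₂ v₃

variable {k : Type u} [Field k] {U : BasedComplex.{u, v₁} k} {V : BasedComplex.{u, v₂} k}
  {W : BasedComplex.{u, v₃} k}

/-- The inclusion of a subcomplex. -/
noncomputable def Sub.map (j : Sub U V) (i : ℕ) : (U.ι i →₀ k) →ₗ[k] (V.ι i →₀ k) :=
  lmapDomain k k (j.emb i)

theorem Sub.map_single (j : Sub U V) (i : ℕ) (a : U.ι i) (c : k) :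
    j.map i (single a c) = single (j.emb i a) c := by
  simp [Sub.map]

theorem Sub.map_injective (j : Sub U V) (i : ℕ) : Function.Injective (j.map i) :=
  mapDomain_injective (j.emb i).injective

theorem Sub.d_map (j : Sub U V) (i : ℕ) (x : U.ι (i + 1) →₀ k) :
    V.d i (j.map (i + 1) x) = j.map i (U.d i x) := by
  suffices h : V.d i ∘ₗ j.map (i + 1) = j.map i ∘ₗ U.d i from LinearMap.congr_fun h x
  apply Finsupp.lhom_ext'
  intro b
  apply LinearMap.ext_ring
  simp only [LinearMap.comp_apply, lsingle_apply, Sub.map_single]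
  exact j.comm i b

theorem d_d (C : BasedComplex.{u, v} k) (i : ℕ) (x : C.ι (i + 2) →₀ k) :
    C.d i (C.d (i + 1) x) = 0 :=
  LinearMap.congr_fun (C.d_comp_d i) x

/-- The cycle condition is quantified over `i = l + 1` so that degree 0, where every vector counts
as a cycle, needs no separate statement. -/
theorem IsExact.exists_d_eq_map (hW : W.IsExact) (j : Sub U W) (i : ℕ) (x : U.ι i →₀ k)
    (hx : ∀ l (h : i = l + 1), U.d l (h ▸ x) = 0) : ∃ w, W.d i w = j.map i x := by
  cases i with
  | zero => exact hW.1 _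
  | succ l =>
    have h : U.d l x = 0 := hx l rfl
    exact (hW.2 l (j.map (l + 1) x)).1 (by rw [j.d_map, h, map_zero])

/-- If the differential of the exact complex `V` takes values in the subcomplex `U`, then in each
degree `V` embeds into every exact complex that contains `U`. -/
theorem exists_injective_of_d_mem_range (j : Sub U V) (j' : Sub U W) (hV : V.IsExact)
    (hW : W.IsExact) (hd : ∀ i x, V.d i x ∈ LinearMap.range (j.map i)) (i : ℕ) :
    ∃ g : (V.ι i →₀ k) →ₗ[k] (W.ι i →₀ k), Function.Injective g := by
  cases i with
  | zero =>
    -- Exactness in degree 0 makes every vector a boundary, hence an element of `U`; so `U` and `V`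
    -- agree there.
    have hsurj : Function.Surjective (j.map 0) := by
      intro v
      obtain ⟨v', rfl⟩ := hV.1 v
      exact hd 0 v'
    refine ⟨j'.map 0 ∘ₗ
      (LinearEquiv.ofBijective (j.map 0) ⟨j.map_injective 0, hsurj⟩).symm.toLinearMap, ?_⟩
    rw [LinearMap.coe_comp]
    exact (j'.map_injective 0).comp (LinearEquiv.injective _)
  | succ i =>
    -- `w` is the image of `b` in `W`: the given copy if `b` comes from `U`, otherwise any element
    -- with the same boundary. Such an element exists because `x`, the boundary of `b` seen in `U`,
    -- is a cycle.
    have key : ∀ b : V.ι (i + 1), ∃ (w : W.ι (i + 1) →₀ k) (x : U.ι i →₀ k),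
        (∀ a, j.emb (i + 1) a = b → w = single (j'.emb (i + 1) a) 1) ∧
        j.map i x = V.d i (single b 1) ∧ W.d i w = j'.map i x := by
      intro b
      by_cases hb : ∃ a, j.emb (i + 1) a = b
      · obtain ⟨a, rfl⟩ := hb
        refine ⟨single (j'.emb (i + 1) a) 1, U.d i (single a 1), ?_, ?_, ?_⟩
        · intro a' ha'
          rw [(j.emb (i + 1)).injective ha']
        · exact (j.comm i a).symm
        · exact j'.comm i a
      · obtain ⟨x, hx⟩ := hd i (single b 1)
        obtain ⟨w, hw⟩ := hW.exists_d_eq_map j' i x (by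
          rintro l rfl
          apply j.map_injective l
          rw [← j.d_map, hx, V.d_d, map_zero])
        exact ⟨w, x, fun a ha => absurd ⟨a, ha⟩ hb, hx, hw⟩
    choose w x hw hx hwx using key
    have h1 : ∀ v, j.map i (linearCombination k x v) = V.d i v := by
      intro v
      suffices h : j.map i ∘ₗ linearCombination k x = V.d i from LinearMap.congr_fun h v
      apply Finsupp.lhom_ext'
      intro b
      apply LinearMap.ext_ring
      simpa using hx b
    have h2 : ∀ v, W.d i (linearCombination k w v) = j'.map i (linearCombination k x v) := by
      intro v
      suffices h : W.d i ∘ₗ linearCombination k w = j'.map i ∘ₗ linearCombination k x from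
        LinearMap.congr_fun h v
      apply Finsupp.lhom_ext'
      intro b
      apply LinearMap.ext_ring
      simpa using hwx b
    have h3 : ∀ y, linearCombination k w (j.map (i + 1) y) = j'.map (i + 1) y := by
      intro y
      suffices h : linearCombination k w ∘ₗ j.map (i + 1) = j'.map (i + 1) from
        LinearMap.congr_fun h y
      apply Finsupp.lhom_ext'
      intro a
      apply LinearMap.ext_ring
      simp [Sub.map_single, hw _ a rfl]
    -- A kernel element is a cycle of `V`, hence a boundary, hence in `U`, where the map is the
    -- inclusion of `U` into `W`.
    refine ⟨linearCombination k w, (injective_iff_map_eq_zero _).2 fun v hv => ?_⟩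
    have h4 : linearCombination k x v = 0 := by
      apply j'.map_injective i
      rw [← h2, hv, map_zero, map_zero]
    obtain ⟨v', rfl⟩ := (hV.2 i v).1 (by rw [← h1, h4, map_zero])
    obtain ⟨y, hy⟩ := hd (i + 1) v'
    rw [← hy, h3] at hv
    rw [← hy, j'.map_injective (i + 1) (hv.trans (map_zero _).symm), map_zero]

theorem finite_ι (C : BasedComplex.{u, v} k) (i : ℕ) : Finite (C.ι i) := by
  have := C.finite
  exact Finite.of_injective (fun b : C.ι i => (⟨i, b⟩ : Σ i, C.ι i)) sigma_mk_injective

/-- An exact complex `V` that contains `U` and whose differential takes values in `U` is an exact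
closure of `U`. -/
theorem Sub.isExactClosure_of_d_mem_range (j : Sub U V) (hV : V.IsExact)
    (hd : ∀ i x, V.d i x ∈ LinearMap.range (j.map i)) : j.IsExactClosure := by
  refine ⟨hV, ?_⟩
  rintro W hW ⟨j'⟩
  have hemb : ∀ i, Nonempty (V.ι i ↪ W.ι i) := by
    intro i
    obtain ⟨g, hg⟩ := exists_injective_of_d_mem_range j j' hV hW hd i
    have := V.finite_ι i
    have := W.finite_ι i
    have := Fintype.ofFinite (V.ι i)
    have := Fintype.ofFinite (W.ι i)
    have h := LinearMap.finrank_le_finrank_of_injective hg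
    rw [Module.finrank_finsupp_self, Module.finrank_finsupp_self] at h
    exact Function.Embedding.nonempty_of_card_le h
  have := W.finite
  exact Nat.card_le_card_of_injective
    (Sigma.map id fun i => (hemb i).some : (Σ i, V.ι i) → Σ i, W.ι i)
    (Function.injective_id.sigma_map fun i => (hemb i).some.injective)

end Rank

end BasedComplex

/-! ### Complexes of chains -/

section ChainComplexes

variable {k : Type u} [Field k] {n r : ℕ}

/-- The differential of the complex of chains with basis `X`. -/
noncomputable def chainD {X : ∀ i, Set (Chain k r i)} (h : BoundaryStable X) (i : ℕ) :
    (X (i + 1) →₀ k) →ₗ[k] (X i →₀ k) :=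
  (chainComplex X h).d i

/-- Evaluating coordinates as chains turns the abstract differential into the boundary map. As
evaluation is injective, identities in the complex can be checked in the simplex. -/
theorem linearCombination_chainD {X : ∀ i, Set (Chain k r i)} (h : BoundaryStable X) (i : ℕ)
    (x : X (i + 1) →₀ k) :
    linearCombination k (Subtype.val : X i → Chain k r i) (chainD h i x)
      = boundary k r i (linearCombination k (Subtype.val : X (i + 1) → Chain k r (i + 1)) x) := by
  induction x using Finsupp.induction_linear with
  | zero => simp
  | add x y hx hy => simp only [map_add, hx, hy]
  | single b c =>
    simp only [chainD, chainComplex, linearCombination_single, map_smul]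
    rw [(h.indep i).linearCombination_repr]

theorem chainD_inclusion {X Y : ∀ i, Set (Chain k r i)} (hX : BoundaryStable X)
    (hY : BoundaryStable Y) (hXY : ∀ i, X i ⊆ Y i) (i : ℕ) (b : X (i + 1)) :
    chainD hY i (single (Set.inclusion (hXY (i + 1)) b) 1)
      = mapDomain (Set.inclusion (hXY i)) (chainD hX i (single b 1)) := by
  apply hY.indep i
  rw [linearCombination_chainD, linearCombination_mapDomain, linearCombination_single]
  change _ = linearCombination k (Subtype.val : X i → Chain k r i) _
  rw [linearCombination_chainD, linearCombination_single]

/-- The inclusion of a set of chains that is stable under the boundary map in another one. -/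
noncomputable def chainComplexSub {X Y : ∀ i, Set (Chain k r i)} (hX : BoundaryStable X)
    (hY : BoundaryStable Y) (hXY : ∀ i, X i ⊆ Y i) :
    BasedComplex.Sub (chainComplex X hX) (chainComplex Y hY) where
  emb i := ⟨Set.inclusion (hXY i), Set.inclusion_injective (hXY i)⟩
  comm i b := chainD_inclusion hX hY hXY i b

/-- Exactness of a complex of chains in terms of the chains. -/
theorem chainComplex_isExact {X : ∀ i, Set (Chain k r i)} (h : BoundaryStable X)
    (h0 : ∀ x ∈ Submodule.span k (X 0), ∃ y ∈ Submodule.span k (X 1), boundary k r 0 y = x)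
    (hs : ∀ i, ∀ x ∈ Submodule.span k (X (i + 1)), boundary k r i x = 0 →
      ∃ y ∈ Submodule.span k (X (i + 2)), boundary k r (i + 1) y = x) :
    (chainComplex X h).IsExact := by
  have key : ∀ i (x : X i →₀ k), (∃ y ∈ Submodule.span k (X (i + 1)), boundary k r i y
      = linearCombination k (Subtype.val : X i → Chain k r i) x) → ∃ y, chainD h i y = x := by
    rintro i x ⟨y, hy, hyx⟩
    obtain ⟨l, rfl⟩ := (mem_span_iff_linearCombination k _ y).1 hy
    refine ⟨l, ?_⟩
    apply h.indep i
    rw [linearCombination_chainD]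
    exact hyx
  have hmem : ∀ i (x : X i →₀ k),
      linearCombination k (Subtype.val : X i → Chain k r i) x ∈ Submodule.span k (X i) :=
    fun i x => (mem_span_iff_linearCombination k _ _).2 ⟨x, rfl⟩
  refine ⟨fun x => key 0 x (h0 _ (hmem 0 x)), fun i (x : X (i + 1) →₀ k) =>
    ⟨fun hx => ?_, ?_⟩⟩
  · refine key (i + 1) x (hs i _ (hmem (i + 1) x) ?_)
    have hx' : chainD h i x = 0 := hx
    rw [← linearCombination_chainD h, hx', map_zero]
  · rintro ⟨y, rfl⟩
    exact (chainComplex X h).d_d i y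

/-! ### Frames of subcomplexes of F as complexes of chains -/

namespace FrameRetraction

variable {m : Fin r → (Fin n →₀ ℕ)} {F : MultigradedComplex.{u, v} k n}
  {B : ∀ i, F.ι i → Chain k r i}

theorem d_single_mem_supported {F : MultigradedComplex.{u, v} k n} {s : LowerSet (Fin n →₀ ℕ)}
    {i : ℕ} {b : F.ι (i + 1)} (hb : F.deg (i + 1) b ∈ s) :
    dehomogenizeMap (F.d i) (single b 1) ∈ supported k k {a | F.deg i a ∈ s} := by
  intro a ha
  rw [Finset.mem_coe, mem_support_iff, dehomogenizeMap_single] at ha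
  exact s.lower (deg_le_of_dehomogenize_ne_zero (F.homogeneous i b) ha) hb

theorem mem_span_iff {X : ∀ i, Set (Chain k r i)} {s : Set (Fin n →₀ ℕ)} {i : ℕ}
    (hX : X i = B i '' {b | F.deg i b ∈ s}) (c : Chain k r i) :
    c ∈ Submodule.span k (X i) ↔
      ∃ x ∈ supported k k {b | F.deg i b ∈ s}, linearCombination k (B i) x = c := by
  rw [hX, mem_span_image_iff_linearCombination]

variable {X : ∀ i, Set (Chain k r i)} {s : LowerSet (Fin n →₀ ℕ)}

/-- Homogeneity alone makes any lower set of multidegrees stable under the differential. The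
hypothesis `hX` lets one argument serve both F(≤ m) and F(< m). -/
theorem boundaryStable (R : FrameRetraction m F B)
    (hX : ∀ i, X i = B i '' {b | F.deg i b ∈ s}) : BoundaryStable X where
  indep i := by
    have h : LinearIndependent k (fun b : {b | F.deg i b ∈ s} => B i b) :=
      (R.linearIndependent i).comp _ Subtype.val_injective
    exact (LinearIndepOn.id_image h).mono (hX i).le
  stable i x hx := by
    rw [hX (i + 1)] at hx
    obtain ⟨b, hb, rfl⟩ := hx
    rw [mem_span_iff (F := F) (B := B) (s := (s : Set (Fin n →₀ ℕ))) (hX i)]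
    exact ⟨_, d_single_mem_supported hb, (R.boundary_basis i b).symm⟩

/-- The bijection between the basis elements with multidegree in `s` and the corresponding
chains. -/
noncomputable def basisEquiv (R : FrameRetraction m F B)
    (hX : ∀ i, X i = B i '' {b | F.deg i b ∈ s}) (i : ℕ) : {b // F.deg i b ∈ s} ≃ X i :=
  Equiv.ofBijective (fun b => ⟨B i b.1, by rw [hX i]; exact ⟨b.1, b.2, rfl⟩⟩) (by
    constructor
    · intro a b hab
      exact Subtype.ext (R.injective i (congrArg Subtype.val hab))
    · rintro ⟨x, hx⟩
      have hx' := hx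
      rw [hX i] at hx'
      obtain ⟨b, hb, rfl⟩ := hx'
      exact ⟨⟨b, hb⟩, rfl⟩)

theorem basisEquiv_apply (R : FrameRetraction m F B)
    (hX : ∀ i, X i = B i '' {b | F.deg i b ∈ s}) (i : ℕ) (b : {b // F.deg i b ∈ s}) :
    (R.basisEquiv hX i b).1 = B i b.1 := rfl

theorem chainD_basisEquiv (R : FrameRetraction m F B)
    (hX : ∀ i, X i = B i '' {b | F.deg i b ∈ s}) (h : BoundaryStable X) (i : ℕ)
    (b : {b // F.deg (i + 1) b ∈ s}) (a : {a // F.deg i a ∈ s}) :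
    chainD h i (single (R.basisEquiv hX (i + 1) b) 1) (R.basisEquiv hX i a)
      = dehomogenizeMap (F.d i) (single b.1 1) a.1 := by
  -- `y` is the differential of `b` restricted to the basis elements with multidegree in `s`;
  -- nothing is lost, since `s` is a lower set.
  set y : {a // F.deg i a ∈ s} →₀ k :=
    comapDomain Subtype.val (dehomogenizeMap (F.d i) (single b.1 1)) Subtype.val_injective.injOn
    with hy
  have hyD : mapDomain Subtype.val y = dehomogenizeMap (F.d i) (single b.1 1) := by
    apply mapDomain_comapDomain _ Subtype.val_injective
    intro a ha
    exact ⟨⟨a, d_single_mem_supported b.2 ha⟩, rfl⟩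
  have key : chainD h i (single (R.basisEquiv hX (i + 1) b) 1)
      = mapDomain (R.basisEquiv hX i) y := by
    apply h.indep i
    rw [linearCombination_chainD, linearCombination_mapDomain, linearCombination_single, one_smul,
      basisEquiv_apply, R.boundary_basis, ← hyD, linearCombination_mapDomain]
    rfl
  rw [key, mapDomain_apply (R.basisEquiv hX i).injective]
  rfl

/-- The differential of the frame of the subcomplex of the basis elements with multidegrees
in `s`. -/
noncomputable def frameRestrictD (F : MultigradedComplex.{u, v} k n) (s : LowerSet (Fin n →₀ ℕ))
    (i : ℕ) : ({b // F.deg (i + 1) b ∈ s} →₀ k) →ₗ[k] ({a // F.deg i a ∈ s} →₀ k) :=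
  (F.restrictDeg s).frame.d i

theorem frameRestrictD_apply (F : MultigradedComplex.{u, v} k n) (s : LowerSet (Fin n →₀ ℕ))
    (i : ℕ) (b : {b // F.deg (i + 1) b ∈ s}) (a : {a // F.deg i a ∈ s}) :
    frameRestrictD F s i (single b 1) a = dehomogenizeMap (F.d i) (single b.1 1) a.1 := by
  have h1 : frameRestrictD F s i (single b 1) = dehomogenize ((F.restrictDeg s).d i (single b 1)) :=
    dehomogenizeMap_single ((F.restrictDeg s).d i) b
  have h2 : ((F.restrictDeg s).d i (single b 1) : {a // F.deg i a ∈ s} →₀ MvPolynomial (Fin n) k) a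
      = F.d i (single b.1 1) a.1 :=
    BasedComplex.restrict_d_single F.toBasedComplex (fun i b => F.deg i b ∈ s)
      (fun i b hb a ha => by
        obtain ⟨e, c, -, h⟩ := F.homogeneous i b a ha
        exact s.lower (h ▸ le_add_self) hb) i b.1 b.2 a.1 a.2
  rw [h1, dehomogenizeMap_single, dehomogenize_apply, ← h2]
  exact dehomogenize_apply _ _

theorem chainD_single_basisEquiv (R : FrameRetraction m F B)
    (hX : ∀ i, X i = B i '' {b | F.deg i b ∈ s}) (h : BoundaryStable X) (i : ℕ)
    (b : {b // F.deg (i + 1) b ∈ s}) :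
    chainD h i (single (R.basisEquiv hX (i + 1) b) 1)
      = mapDomain (R.basisEquiv hX i) (frameRestrictD F s i (single b 1)) := by
  ext1 a
  obtain ⟨a, rfl⟩ := (R.basisEquiv hX i).surjective a
  rw [R.chainD_basisEquiv, mapDomain_apply (R.basisEquiv hX i).injective, frameRestrictD_apply]

/-- The frame of the subcomplex of the basis elements with multidegrees in `s` is the complex of
the corresponding chains. -/
noncomputable def frameSame (R : FrameRetraction m F B)
    (hX : ∀ i, X i = B i '' {b | F.deg i b ∈ s}) (h : BoundaryStable X) :
    (F.restrictDeg s).frame.Same (chainComplex X h) where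
  equiv i := R.basisEquiv hX i
  comm i b := R.chainD_single_basisEquiv hX h i b

theorem chainComplex_le_isExact (R : FrameRetraction m F B) {ν : Fin n →₀ ℕ} {j : Fin r}
    (hj : m j ≤ ν) (hX : ∀ i, X i = B i '' {b | F.deg i b ∈ LowerSet.Iic ν})
    (h : BoundaryStable X) : (chainComplex X h).IsExact := by
  have hspan := fun i c =>
    mem_span_iff (F := F) (B := B) (i := i) (s := {μ | μ ≤ ν}) (hX i) c
  apply chainComplex_isExact
  · intro c hc
    obtain ⟨x, hx, rfl⟩ := (hspan 0 c).1 hc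
    obtain ⟨z, hz, rfl⟩ := R.exists_d_zero_eq hj hx
    exact ⟨_, (hspan 1 _).2 ⟨z, hz, rfl⟩, R.boundary_linearCombination 0 z⟩
  · intro i c hc h0
    obtain ⟨x, hx, rfl⟩ := (hspan (i + 1) c).1 hc
    rw [R.boundary_linearCombination] at h0
    have h0' : dehomogenizeMap (F.d i) x = 0 := R.linearIndependent i (by rw [h0, map_zero])
    obtain ⟨z, hz, rfl⟩ := R.exists_d_succ_eq hj hx h0'
    exact ⟨_, (hspan (i + 2) _).2 ⟨z, hz, rfl⟩, R.boundary_linearCombination (i + 1) z⟩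

/-- Exactness comes from the cone, which needs a generator dividing x^ν; that boundaries fall into
the smaller complex comes from minimality. -/
theorem chainComplexSub_isExactClosure (R : FrameRetraction m F B)
    {M : Ideal (MvPolynomial (Fin n) k)} (hF : F.IsMinimalFreeResolution M)
    {ν : Fin n →₀ ℕ} {j : Fin r} (hj : m j ≤ ν) {X Y : ∀ i, Set (Chain k r i)}
    (hX : ∀ i, X i = B i '' {b | F.deg i b ∈ LowerSet.Iio ν})
    (hY : ∀ i, Y i = B i '' {b | F.deg i b ∈ LowerSet.Iic ν})
    (hX' : BoundaryStable X) (hY' : BoundaryStable Y) (hXY : ∀ i, X i ⊆ Y i) :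
    (chainComplexSub hX' hY' hXY).IsExactClosure := by
  apply BasedComplex.Sub.isExactClosure_of_d_mem_range
  · exact R.chainComplex_le_isExact hj hY hY'
  · intro i (y : Y (i + 1) →₀ k)
    have hy : linearCombination k (Subtype.val : Y (i + 1) → Chain k r (i + 1)) y
        ∈ Submodule.span k (Y (i + 1)) := (mem_span_iff_linearCombination k _ _).2 ⟨y, rfl⟩
    obtain ⟨x, hx, hxy⟩ :=
      (mem_span_iff (F := F) (B := B) (s := {μ | μ ≤ ν}) (hY (i + 1)) _).1 hy
    have hz : boundary k r i (linearCombination k (B (i + 1)) x) ∈ Submodule.span k (X i) := by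
      rw [mem_span_iff (F := F) (B := B) (s := {μ | μ < ν}) (hX i), R.boundary_linearCombination]
      exact ⟨_, hF.d_mem_supported hx, rfl⟩
    obtain ⟨z, hz⟩ := (mem_span_iff_linearCombination k _ _).1 hz
    refine ⟨z, ?_⟩
    change mapDomain (Set.inclusion (hXY i)) z = chainD hY' i y
    apply hY'.indep i
    rw [linearCombination_chainD, ← hxy, ← hz, linearCombination_mapDomain]
    rfl

end FrameRetraction

end ChainComplexes

/-! ### Multidegrees in the minimal free resolution of a monomial ideal -/

section MinimalGenerators

variable {k : Type u} [Field k] {n r : ℕ} {M : Ideal (MvPolynomial (Fin n) k)}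
  {m : Fin r → (Fin n →₀ ℕ)}

theorem IsMinimallyGeneratedBy.ne_zero (hM : IsMinimallyGeneratedBy M m) (hM_proper : M ≠ ⊤)
    (j : Fin r) : m j ≠ 0 := by
  intro h
  apply hM_proper
  rw [Ideal.eq_top_iff_one, hM.1]
  exact Ideal.subset_span ⟨j, by simp [h]⟩

theorem IsMinimallyGeneratedBy.eq_of_le (hM : IsMinimallyGeneratedBy M m) {l j : Fin r}
    (h : m l ≤ m j) : l = j := by
  by_contra hlj
  apply hM.2 j
  have h1 : MvPolynomial.monomial (m j) (1 : k)
      = MvPolynomial.monomial (m j - m l) 1 * MvPolynomial.monomial (m l) 1 := by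
    rw [MvPolynomial.monomial_mul, tsub_add_cancel_of_le h, one_mul]
  rw [h1]
  exact Ideal.mul_mem_left _ _ (Ideal.subset_span ⟨l, hlj, rfl⟩)

/-- Otherwise the augmentation would be a surjection from 0 onto the nonzero module S/M. -/
theorem MultigradedComplex.IsFreeResolution.nonempty_ι_zero {F : MultigradedComplex.{u, v} k n}
    (hF : F.IsFreeResolution M) (hM : M ≠ ⊤) : Nonempty (F.ι 0) := by
  by_contra h
  rw [not_nonempty_iff] at h
  obtain ⟨-, ε, hε, -⟩ := hF
  apply hM
  rw [Ideal.eq_top_iff_one, ← Ideal.Quotient.eq_zero_iff_mem]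
  obtain ⟨x, hx⟩ := hε (Ideal.Quotient.mk M 1)
  rw [← hx, Subsingleton.elim x 0, map_zero]

end MinimalGenerators

/-! ### Low homological degrees, and multidegrees as lcms -/

namespace FrameRetraction

variable {k : Type u} [Field k] {n r : ℕ} {M : Ideal (MvPolynomial (Fin n) k)}
  {m : Fin r → (Fin n →₀ ℕ)} {F : MultigradedComplex.{u, v} k n} {B : ∀ i, F.ι i → Chain k r i}

theorem basis_ne_zero (R : FrameRetraction m F B) (i : ℕ) (b : F.ι i) : B i b ≠ 0 :=
  (R.linearIndependent i).ne_zero b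

/-- Independent chains cannot both be multiples of one face. This gives uniqueness of the basis
element in degree 0 and of the one attached to each generator. -/
theorem eq_of_basis_eq_single (R : FrameRetraction m F B) {i : ℕ} {b b' : F.ι i} {A : Face r i}
    {c c' : k} (h : B i b = single A c) (h' : B i b' = single A c') : b = b' := by
  classical
  by_contra hne
  have hs : ∀ c : k, R.retr i (single A c) = c • R.retr i (single A 1) := by
    intro c
    rw [← map_smul, smul_single, smul_eq_mul, mul_one]
  have h1 := R.retr_basis i b
  have h2 := R.retr_basis i b'
  rw [h, hs] at h1
  rw [h', hs] at h2
  have e1 := DFunLike.congr_fun h1 b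
  have e2 := DFunLike.congr_fun h2 b
  have e3 := DFunLike.congr_fun h2 b'
  simp only [Finsupp.smul_apply, smul_eq_mul, single_eq_same, single_apply, if_neg (Ne.symm hne)]
    at e1 e2 e3
  rcases mul_eq_zero.1 e2 with h0 | h0
  · rw [h0, zero_mul] at e3
    exact zero_ne_one e3
  · rw [h0, mul_zero] at e1
    exact zero_ne_one e1

theorem basis_zero_eq_single (b : F.ι 0) : ∃ c : k, B 0 b = single ⟨∅, rfl⟩ c := by
  refine ⟨B 0 b ⟨∅, rfl⟩, ?_⟩
  ext A
  have hA : A = ⟨∅, rfl⟩ := Subtype.ext (Finset.card_eq_zero.1 A.2)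
  rw [hA, single_eq_same]

theorem subsingleton_ι_zero (R : FrameRetraction m F B) (b b' : F.ι 0) : b = b' := by
  obtain ⟨c, h⟩ := basis_zero_eq_single (B := B) b
  obtain ⟨c', h'⟩ := basis_zero_eq_single (B := B) b'
  exact R.eq_of_basis_eq_single h h'

theorem deg_zero (R : FrameRetraction m F B) (b : F.ι 0) : F.deg 0 b = 0 := by
  rw [← R.mdeg_basis, ← nonpos_iff_eq_zero]
  refine Finset.sup_le fun A _ => ?_
  rw [Finset.card_eq_zero.1 A.2, Finset.sup_empty]
  exact bot_le

theorem exists_generator_le (R : FrameRetraction m F B) {i : ℕ} (b : F.ι (i + 1)) :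
    ∃ j, m j ≤ F.deg (i + 1) b := by
  obtain ⟨A, hA⟩ := Finsupp.ne_iff.1 (R.basis_ne_zero (i + 1) b)
  obtain ⟨j, hj⟩ : A.1.Nonempty := by
    rw [← Finset.card_pos, A.2]
    exact Nat.succ_pos i
  exact ⟨j, (Finset.le_sup hj).trans (R.deg_basis (i + 1) b A hA)⟩

/-- No basis element of a minimal resolution is homologous to a combination of other basis
elements whose multidegrees divide its own. -/
theorem d_ne_d_single (R : FrameRetraction m F B) (hF : F.IsMinimalFreeResolution M) {i : ℕ}
    (b : F.ι (i + 1)) {y : F.ι (i + 1) →₀ k}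
    (hy : y ∈ supported k k {a | F.deg (i + 1) a ≤ F.deg (i + 1) b}) (hyb : y b = 0) :
    dehomogenizeMap (F.d i) y ≠ dehomogenizeMap (F.d i) (single b 1) := by
  intro h
  obtain ⟨j, hj⟩ := R.exists_generator_le b
  -- This cycle has coefficient 1 at `b`. By exactness it is a boundary within F(≤ deg b), and by
  -- minimality such a boundary involves only strictly smaller multidegrees.
  have hx : single b 1 - y ∈ supported k k {a | F.deg (i + 1) a ≤ F.deg (i + 1) b} :=
    sub_mem (single_mem_supported k 1 (Set.mem_ofPred.2 le_rfl)) hy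
  obtain ⟨z, hz, hzx⟩ := R.exists_d_succ_eq hj hx (by rw [map_sub, h, sub_self])
  have hmem := hF.d_mem_supported hz
  rw [hzx] at hmem
  refine lt_irrefl (F.deg (i + 1) b) (hmem ?_)
  rw [Finset.mem_coe, mem_support_iff, Finsupp.sub_apply, single_eq_same, hyb, sub_zero]
  exact one_ne_zero

theorem d_single_ne_zero (R : FrameRetraction m F B) (hF : F.IsMinimalFreeResolution M) {i : ℕ}
    (b : F.ι (i + 1)) : dehomogenizeMap (F.d i) (single b 1) ≠ 0 := by
  have h := R.d_ne_d_single hF b (zero_mem _) rfl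
  rw [map_zero] at h
  exact h.symm

/-- Exactness over `m j` in degree 0 forces something there to map onto the basis element in degree
0. -/
theorem exists_basis_one (R : FrameRetraction m F B) (hne : Nonempty (F.ι 0)) (j : Fin r) :
    ∃ b : F.ι 1, F.deg 1 b ≤ m j := by
  obtain ⟨a⟩ := hne
  obtain ⟨z, hz, hza⟩ := R.exists_d_zero_eq (le_refl (m j)) (x := single a 1)
    (single_mem_supported k 1 (by simp [R.deg_zero a]))
  have hz0 : z ≠ 0 := by
    rintro rfl
    rw [map_zero] at hza
    exact one_ne_zero (single_eq_zero.1 hza.symm)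
  obtain ⟨b, hb⟩ := Finsupp.ne_iff.1 hz0
  exact ⟨b, hz (mem_support_iff.2 hb)⟩

theorem face_eq_singleton (hinc : ∀ l j, m l ≤ m j → l = j) {j : Fin r} {i : ℕ}
    (A : Face r (i + 1)) (hA : A.1.sup m ≤ m j) : A.1 = {j} := by
  have hsub : ∀ l ∈ A.1, l = j := fun l hl => hinc l j ((Finset.le_sup hl).trans hA)
  obtain ⟨l, hl⟩ : A.1.Nonempty := by
    rw [← Finset.card_pos, A.2]
    exact Nat.succ_pos i
  rw [Finset.eq_singleton_iff_unique_mem]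
  exact ⟨hsub l hl ▸ hl, hsub⟩

theorem deg_ne_generator (R : FrameRetraction m F B) (hinc : ∀ l j, m l ≤ m j → l = j) {i : ℕ}
    (b : F.ι (i + 2)) (j : Fin r) : F.deg (i + 2) b ≠ m j := by
  intro h
  obtain ⟨A, hA⟩ := Finsupp.ne_iff.1 (R.basis_ne_zero (i + 2) b)
  have h1 := face_eq_singleton hinc A ((R.deg_basis (i + 2) b A hA).trans h.le)
  have h2 := A.2
  rw [h1, Finset.card_singleton] at h2
  omega

theorem basis_one_eq_single (R : FrameRetraction m F B) (hinc : ∀ l j, m l ≤ m j → l = j)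
    {b : F.ι 1} {j : Fin r} (h : F.deg 1 b ≤ m j) :
    ∃ c : k, B 1 b = single ⟨{j}, Finset.card_singleton j⟩ c := by
  classical
  refine ⟨B 1 b ⟨{j}, Finset.card_singleton j⟩, ?_⟩
  ext A
  by_cases hA : B 1 b A = 0
  · rw [hA, single_apply]
    split_ifs with h1
    · rw [h1, hA]
    · rfl
  · have hA' : A = ⟨{j}, Finset.card_singleton j⟩ :=
      Subtype.ext (face_eq_singleton hinc A ((R.deg_basis 1 b A hA).trans h))
    rw [hA', single_eq_same]

/-- The basis elements in degree `1` have the generators as their multidegrees. -/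
theorem exists_deg_one_eq (R : FrameRetraction m F B) (hF : F.IsMinimalFreeResolution M)
    (hne : Nonempty (F.ι 0)) (b : F.ι 1) : ∃ j, F.deg 1 b = m j := by
  obtain ⟨j, hj⟩ := R.exists_generator_le b
  refine ⟨j, ?_⟩
  obtain ⟨b', hb'⟩ := R.exists_basis_one hne j
  obtain ⟨a⟩ := hne
  have hspan : ∀ x : F.ι 0 →₀ k, x = single a (x a) := by
    intro x
    ext a'
    rw [R.subsingleton_ι_zero a' a, single_eq_same]
  by_contra hbj
  have hbb' : b' ≠ b := by
    rintro rfl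
    exact hbj (le_antisymm hb' hj)
  have hγ : dehomogenizeMap (F.d 0) (single b' 1) a ≠ 0 := by
    intro h
    apply R.d_single_ne_zero hF b'
    rw [hspan (dehomogenizeMap (F.d 0) (single b' 1)), h, single_zero]
  set β := dehomogenizeMap (F.d 0) (single b 1) a with hβ
  set γ := dehomogenizeMap (F.d 0) (single b' 1) a with hγ'
  -- Degree 0 is one-dimensional, so this scalar makes the boundaries of `b` and of the multiple of
  -- `b'` agree.
  refine R.d_ne_d_single hF b (y := (β / γ) • single b' 1) ?_ ?_ ?_
  · exact Submodule.smul_mem _ _ (single_mem_supported k 1 (hb'.trans hj))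
  · rw [Finsupp.smul_apply, single_eq_of_ne (Ne.symm hbb'), smul_zero]
  · rw [map_smul, hspan (dehomogenizeMap (F.d 0) (single b' 1)),
      hspan (dehomogenizeMap (F.d 0) (single b 1)), smul_single, smul_eq_mul, ← hβ, ← hγ',
      div_mul_cancel₀ _ hγ]

theorem d_d_single (F : MultigradedComplex.{u, v} k n) (i : ℕ) (b : F.ι (i + 2)) :
    dehomogenizeMap (F.d i) (dehomogenizeMap (F.d (i + 1)) (single b 1)) = 0 := by
  rw [dehomogenizeMap_single, dehomogenizeMap_dehomogenize]
  have h := LinearMap.congr_fun (F.d_comp_d i) (single b 1)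
  rw [LinearMap.comp_apply, LinearMap.zero_apply] at h
  rw [h, dehomogenize_zero]

/-- In degrees at least `2` the multidegree of a basis element is the lcm of the multidegrees of
the basis elements that occur in its differential. -/
theorem deg_eq_sup_support (R : FrameRetraction m F B) (hF : F.IsMinimalFreeResolution M) {i : ℕ}
    (b : F.ι (i + 2)) : F.deg (i + 2) b
      = (dehomogenizeMap (F.d (i + 1)) (single b 1)).support.sup (F.deg (i + 1)) := by
  set x := dehomogenizeMap (F.d (i + 1)) (single b 1) with hx
  have hle : x.support.sup (F.deg (i + 1)) ≤ F.deg (i + 2) b :=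
    Finset.sup_le fun a ha => (hF.deg_lt (mem_support_iff.1 ha)).le
  refine le_antisymm ?_ hle
  by_contra hnot
  -- A nonzero term of the differential supplies a generator dividing the lcm, so exactness below
  -- the lcm applies. The primitive `y` found there cannot involve `b`.
  obtain ⟨a, ha⟩ := Finsupp.ne_iff.1 (R.d_single_ne_zero hF b)
  obtain ⟨j, hj⟩ := R.exists_generator_le a
  have hj' : m j ≤ x.support.sup (F.deg (i + 1)) :=
    hj.trans (Finset.le_sup (f := F.deg (i + 1)) (mem_support_iff.2 ha))
  have hxs : x ∈ supported k k {a | F.deg (i + 1) a ≤ x.support.sup (F.deg (i + 1))} :=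
    fun a ha => Finset.le_sup (f := F.deg (i + 1)) ha
  obtain ⟨y, hy, hyx⟩ := R.exists_d_succ_eq hj' hxs (d_d_single F i b)
  refine R.d_ne_d_single hF b (y := y) (fun a ha => le_trans (hy ha) hle) ?_ hyx
  by_contra hyb
  exact hnot (hy (mem_support_iff.2 hyb))

end FrameRetraction

/-! ### Taylor bases and the construction -/

namespace FrameRetraction

variable {k : Type u} [Field k] {n r : ℕ} {M : Ideal (MvPolynomial (Fin n) k)}
  {m : Fin r → (Fin n →₀ ℕ)} {F : MultigradedComplex.{u, v} k n} {B : ∀ i, F.ι i → Chain k r i}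

theorem mem_elementsOfDegree_iff (R : FrameRetraction m F B) (μ : LcmLattice m) (i : ℕ)
    (f : Chain k r i) :
    f ∈ elementsOfDegree m B μ i ↔ ∃ b, F.deg i b = μ.1 ∧ B i b = f := by
  constructor
  · rintro ⟨⟨b, rfl⟩, hb⟩
    exact ⟨b, by rw [← R.mdeg_basis, hb], rfl⟩
  · rintro ⟨b, hb, rfl⟩
    exact ⟨⟨b, rfl⟩, by rw [R.mdeg_basis, hb]⟩

/-- Every multidegree of F is in the lcm-lattice, so the union over lattice elements below `μ`
misses nothing. -/
theorem upTo_elementsOfDegree (R : FrameRetraction m F B) (μ : LcmLattice m) (i : ℕ) :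
    upTo (elementsOfDegree m B) μ i = B i '' {b | F.deg i b ∈ LowerSet.Iic μ.1} := by
  ext f
  simp only [upTo, Set.mem_iUnion, R.mem_elementsOfDegree_iff]
  constructor
  · rintro ⟨β, hβ, b, hb, rfl⟩
    exact ⟨b, hb.trans_le hβ, rfl⟩
  · rintro ⟨b, hb, rfl⟩
    exact ⟨⟨F.deg i b, R.deg_mem_lcmLattice i b⟩, hb, b, rfl, rfl⟩

theorem below_elementsOfDegree (R : FrameRetraction m F B) (μ : LcmLattice m) (i : ℕ) :
    below (elementsOfDegree m B) μ i = B i '' {b | F.deg i b ∈ LowerSet.Iio μ.1} := by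
  ext f
  simp only [below, Set.mem_iUnion, R.mem_elementsOfDegree_iff]
  constructor
  · rintro ⟨β, hβ, b, hb, rfl⟩
    exact ⟨b, hb.trans_lt (Subtype.coe_lt_coe.2 hβ), rfl⟩
  · rintro ⟨b, hb, rfl⟩
    exact ⟨⟨F.deg i b, R.deg_mem_lcmLattice i b⟩, Subtype.coe_lt_coe.1 hb, b, rfl, rfl⟩

end FrameRetraction

theorem LcmLattice.exists_generator_le {n r : ℕ} {m : Fin r → (Fin n →₀ ℕ)} {μ : LcmLattice m}
    (hμ : μ ≠ ⊥) : ∃ j, m j ≤ μ.1 := by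
  obtain ⟨_, A, rfl⟩ := μ
  rcases A.eq_empty_or_nonempty with rfl | ⟨j, hj⟩
  · exact absurd rfl hμ
  · exact ⟨j, Finset.le_sup (f := m) hj⟩

/-! ### The Taylor basis as an outcome of the construction -/

namespace FrameRetraction

variable {k : Type u} [Field k] {n r : ℕ} {M : Ideal (MvPolynomial (Fin n) k)}
  {m : Fin r → (Fin n →₀ ℕ)} {F : MultigradedComplex.{u, v} k n} {B : ∀ i, F.ι i → Chain k r i}

/-- The exact closure is chosen to be the complex of chains up to `μ` itself, so the replacement of
basis elements by chains is the tautological map. -/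
theorem isTaylorStep (R : FrameRetraction m F B) (hF : F.IsMinimalFreeResolution M)
    {μ : LcmLattice m} (hμ : μ ≠ ⊥) :
    IsTaylorStep (LcmLattice.atom m) (elementsOfDegree m B) μ := by
  obtain ⟨j, hj⟩ := LcmLattice.exists_generator_le hμ
  have hU := R.boundaryStable (R.below_elementsOfDegree μ)
  have hV := R.boundaryStable (R.upTo_elementsOfDegree μ)
  have hUV : ∀ i, below (elementsOfDegree m B) μ i ⊆ upTo (elementsOfDegree m B) μ i := by
    intro i f hf
    simp only [below, upTo, Set.mem_iUnion] at hf ⊢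
    obtain ⟨β, hβ, hf⟩ := hf
    exact ⟨β, hβ.le, hf⟩
  -- A chain has only one multidegree, so the elements added at `μ` are exactly those of multidegree
  -- `μ`.
  have hmem : ∀ i (f : upTo (elementsOfDegree m B) μ i),
      f ∉ Set.range (Set.inclusion (hUV i)) ↔ f.1 ∈ elementsOfDegree m B μ i := by
    rintro i ⟨f, hf⟩
    rw [Set.range_inclusion, Set.mem_ofPred_eq]
    constructor
    · intro h
      simp only [upTo, below, Set.mem_iUnion] at hf h
      obtain ⟨β, hβ, hfβ⟩ := hf
      rcases hβ.eq_or_lt with rfl | hlt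
      · exact hfβ
      · exact absurd ⟨β, hlt, hfβ⟩ h
    · rintro hfμ h
      simp only [below, Set.mem_iUnion] at h
      obtain ⟨β, hβ, hfβ⟩ := h
      exact hβ.ne (Subtype.ext (hfβ.2.symm.trans hfμ.2))
  refine ⟨hU, chainComplex _ hV, chainComplexSub hU hV hUV, fun i => Subtype.val,
    R.chainComplexSub_isExactClosure hF hj (R.below_elementsOfDegree μ)
      (R.upTo_elementsOfDegree μ) hU hV hUV, fun i x => rfl, fun i => ⟨?_, ?_, ?_⟩, ?_, ?_⟩
  · intro f hf
    exact (hmem i f).1 hf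
  · exact Subtype.val_injective.injOn
  · intro f hf
    have hf' : f ∈ upTo (elementsOfDegree m B) μ i := by
      simp only [upTo, Set.mem_iUnion]
      exact ⟨μ, le_rfl, hf⟩
    exact ⟨⟨f, hf'⟩, (hmem i ⟨f, hf'⟩).2 hf, rfl⟩
  · intro i f hf l hl
    have hfμ := ((hmem i f).1 hf).2
    obtain ⟨A, hA, hlA⟩ := Finset.mem_sup.1 hl
    change m l ≤ μ.1
    rw [← hfμ]
    exact (Finset.le_sup (f := m) hlA).trans
      (Finset.le_sup (f := fun A : Face r i => A.1.sup m) hA)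
  · intro i (f : upTo (elementsOfDegree m B) μ (i + 1)) _
    have h := linearCombination_chainD hV i (single f 1)
    rw [linearCombination_single, one_smul] at h
    exact h.symm

theorem isTaylorConstruction (R : FrameRetraction m F B) (hF : F.IsMinimalFreeResolution M)
    (hne : Nonempty (F.ι 0)) (hpos : ∀ j, m j ≠ 0) (hinc : ∀ l j, m l ≤ m j → l = j) :
    IsTaylorConstruction (LcmLattice.atom m) (elementsOfDegree m B) where
  bot := by
    obtain ⟨a⟩ := hne
    obtain ⟨c, hc⟩ := basis_zero_eq_single (B := B) a
    refine ⟨c, ?_, ?_, ?_⟩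
    · rintro rfl
      exact R.basis_ne_zero 0 a (hc.trans (single_zero _))
    · ext f
      rw [R.mem_elementsOfDegree_iff, Set.mem_singleton_iff, ← hc]
      constructor
      · rintro ⟨b, -, rfl⟩
        rw [R.subsingleton_ι_zero b a]
      · rintro rfl
        exact ⟨a, R.deg_zero a, rfl⟩
    · intro i
      rw [Set.eq_empty_iff_forall_notMem]
      intro f hf
      obtain ⟨b, hb, rfl⟩ := (R.mem_elementsOfDegree_iff _ _ _).1 hf
      obtain ⟨j, hj⟩ := R.exists_generator_le b
      rw [hb] at hj
      exact hpos j (le_antisymm hj bot_le)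
  atoms j := by
    obtain ⟨b, hb⟩ := R.exists_basis_one hne j
    obtain ⟨c, hc⟩ := R.basis_one_eq_single hinc hb
    -- Some generator divides the multidegree of `b`, hence divides `m j`; by minimality of the
    -- generators it is `m j`.
    have hbj : F.deg 1 b = m j := by
      obtain ⟨l, hl⟩ := R.exists_generator_le b
      have hlj := hinc l j (hl.trans hb)
      exact le_antisymm hb (hlj ▸ hl)
    refine ⟨c, ?_, ?_, ?_, ?_⟩
    · rintro rfl
      exact R.basis_ne_zero 1 b (hc.trans (single_zero _))
    · rw [Set.eq_empty_iff_forall_notMem]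
      intro f hf
      obtain ⟨a, ha, rfl⟩ := (R.mem_elementsOfDegree_iff _ _ _).1 hf
      rw [R.deg_zero] at ha
      exact hpos j ha.symm
    · ext f
      rw [R.mem_elementsOfDegree_iff, Set.mem_singleton_iff, ← hc]
      constructor
      · rintro ⟨b', hb', rfl⟩
        obtain ⟨c', hc'⟩ := R.basis_one_eq_single hinc (b := b') (j := j) hb'.le
        rw [R.eq_of_basis_eq_single hc' hc]
      · rintro rfl
        exact ⟨b, hbj, rfl⟩
    · intro i
      rw [Set.eq_empty_iff_forall_notMem]
      intro f hf
      obtain ⟨b, hb, rfl⟩ := (R.mem_elementsOfDegree_iff _ _ _).1 hf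
      exact R.deg_ne_generator hinc b j hb
  step μ hμ _ := R.isTaylorStep hF hμ

/-- The bijection between the basis of `F` and the chains of all multidegrees. -/
noncomputable def basisEquivTop (R : FrameRetraction m F B) (i : ℕ) :
    F.ι i ≃ upTo (elementsOfDegree m B) ⊤ i :=
  (Equiv.subtypeUnivEquiv fun b => show F.deg i b ∈ LowerSet.Iic (⊤ : LcmLattice m).1 from
    le_top (a := (⟨F.deg i b, R.deg_mem_lcmLattice i b⟩ : LcmLattice m))).symm.trans
    (R.basisEquiv (R.upTo_elementsOfDegree ⊤) i)

theorem chainD_basisEquivTop (R : FrameRetraction m F B)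
    (h : BoundaryStable (upTo (elementsOfDegree m B) ⊤)) (i : ℕ) (b : F.ι (i + 1)) (a : F.ι i) :
    chainD h i (single (R.basisEquivTop (i + 1) b) 1) (R.basisEquivTop i a)
      = dehomogenizeMap (F.d i) (single b 1) a :=
  R.chainD_basisEquiv (R.upTo_elementsOfDegree ⊤) h i _ _

/-- The entries of the differentials are determined by the frame and the multidegrees. -/
theorem d_single_apply (F : MultigradedComplex.{u, v} k n) (i : ℕ) (b : F.ι (i + 1)) (a : F.ι i) :
    F.d i (single b 1) a = MvPolynomial.monomial (F.deg (i + 1) b - F.deg i a)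
      (dehomogenizeMap (F.d i) (single b 1) a) := by
  rw [dehomogenizeMap_single, dehomogenize_apply]
  by_cases h : F.d i (single b 1) a = 0
  · rw [h, map_zero, MvPolynomial.monomial_zero]
  · obtain ⟨e, c, hec, hdeg⟩ := F.homogeneous i b a h
    rw [hec, ← hdeg, add_tsub_cancel_right, MvPolynomial.eval_monomial]
    simp

/-- Homogenizing the frame gives back F because the frame determines the multidegrees (generators in
degree 1, lcms above), and these with the frame determine every entry of the differentials. -/
theorem isAtomicLatticeResolution (R : FrameRetraction m F B) (hF : F.IsMinimalFreeResolution M)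
    (hne : Nonempty (F.ι 0)) (hpos : ∀ j, m j ≠ 0) (hinc : ∀ l j, m l ≤ m j → l = j) :
    IsAtomicLatticeResolution m F := by
  have h := R.boundaryStable (R.upTo_elementsOfDegree ⊤)
  choose gen hgen using R.exists_deg_one_eq hF hne
  have hinj : Function.Injective gen := by
    intro b b' hbb'
    obtain ⟨c, hc⟩ := R.basis_one_eq_single hinc (hgen b).le
    obtain ⟨c', hc'⟩ := R.basis_one_eq_single hinc (hgen b').le
    rw [← hbb'] at hc'
    exact R.eq_of_basis_eq_single hc hc'
  have hsurj : Function.Surjective gen := by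
    intro j
    obtain ⟨b, hb⟩ := R.exists_basis_one hne j
    exact ⟨b, hinc _ _ ((hgen b).symm.trans_le hb)⟩
  -- Injective because basis elements of multidegree `m j` are multiples of the vertex `j`;
  -- surjective because some basis element has multidegree dividing `m j`.
  set label := Equiv.ofBijective gen ⟨hinj, hsurj⟩ with hlabel
  refine ⟨elementsOfDegree m B, h, (R.basisEquivTop 1).symm.trans label,
    R.isTaylorConstruction hF hne hpos hinc, ?_, ?_, ?_⟩
  · intro j
    rw [R.mem_elementsOfDegree_iff]
    refine ⟨label.symm j, ?_, rfl⟩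
    rw [hgen]
    exact congrArg m (label.apply_symm_apply j)
  · obtain ⟨a⟩ := hne
    refine ⟨R.basisEquivTop 0 a, ?_, ?_⟩
    · intro a'
      obtain ⟨a', rfl⟩ := (R.basisEquivTop 0).surjective a'
      rw [R.subsingleton_ι_zero a' a]
    · intro b
      obtain ⟨b, rfl⟩ := (R.basisEquivTop 1).surjective b
      change chainD h 0 (single (R.basisEquivTop 1 b) 1) (R.basisEquivTop 0 a) ≠ 0
      rw [R.chainD_basisEquivTop]
      obtain ⟨a', ha'⟩ := Finsupp.ne_iff.1 (R.d_single_ne_zero hF b)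
      rwa [R.subsingleton_ι_zero a' a] at ha'
  · refine ⟨R.basisEquivTop, R.deg_zero, ?_, ?_, ?_⟩
    · intro b
      rw [hgen b]
      exact congrArg (fun b => m (label b)) ((R.basisEquivTop 1).symm_apply_apply b).symm
    · intro i b
      change _ = (chainD h (i + 1) (single (R.basisEquivTop (i + 2) b) 1)).support.sup
        fun a => F.deg (i + 1) ((R.basisEquivTop (i + 1)).symm a)
      rw [R.deg_eq_sup_support hF b]
      apply le_antisymm
      · refine Finset.sup_le fun a ha => ?_
        have ha' : R.basisEquivTop (i + 1) a
            ∈ (chainD h (i + 1) (single (R.basisEquivTop (i + 2) b) 1)).support := by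
          rw [mem_support_iff, R.chainD_basisEquivTop]
          exact mem_support_iff.1 ha
        refine le_trans ?_ (Finset.le_sup ha')
        rw [Equiv.symm_apply_apply]
      · refine Finset.sup_le fun a ha => ?_
        obtain ⟨a, rfl⟩ := (R.basisEquivTop (i + 1)).surjective a
        rw [mem_support_iff, R.chainD_basisEquivTop] at ha
        rw [Equiv.symm_apply_apply]
        exact Finset.le_sup (f := F.deg (i + 1)) (mem_support_iff.2 ha)
    · intro i b a
      rw [d_single_apply]
      congr 1
      exact (R.chainD_basisEquivTop h i b a).symm

end FrameRetraction

/-- The bijections of bases in the second part are required to be given by `B` itself, which is more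
than the existence of some isomorphism of based complexes. -/
theorem mainTheorem2 {k : Type u} [Field k] {n r : ℕ}
    (M : Ideal (MvPolynomial (Fin n) k)) (m : Fin r → (Fin n →₀ ℕ))
    (hM : IsMinimallyGeneratedBy M m) (hM_proper : M ≠ ⊤)
    (F : MultigradedComplex.{u, v} k n) (hF : F.IsMinimalFreeResolution M)
    (B : ∀ i, F.ι i → Chain k r i) (hB : IsTaylorBasis m F B) :
    IsTaylorConstruction (LcmLattice.atom m) (elementsOfDegree m B) ∧
    (∀ μ : LcmLattice m, μ ≠ ⊥ →
      (∃ (h : BoundaryStable (upTo (elementsOfDegree m B) μ))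
          (e : (F.le μ.1).frame.Same (chainComplex (upTo (elementsOfDegree m B) μ) h)),
          ∀ i (b : (F.le μ.1).ι i), (e.equiv i b).1 = B i b.1) ∧
      (∃ (h : BoundaryStable (below (elementsOfDegree m B) μ))
          (e : (F.lt μ.1).frame.Same (chainComplex (below (elementsOfDegree m B) μ) h)),
          ∀ i (b : (F.lt μ.1).ι i), (e.equiv i b).1 = B i b.1)) ∧
    IsAtomicLatticeResolution m F := by
  obtain ⟨R⟩ := hB.nonempty_frameRetraction
  have hne := hF.1.nonempty_ι_zero hM_proper
  have hpos := hM.ne_zero hM_proper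
  have hinc : ∀ l j, m l ≤ m j → l = j := fun l j h => hM.eq_of_le h
  refine ⟨R.isTaylorConstruction hF hne hpos hinc, fun μ _ => ⟨?_, ?_⟩,
    R.isAtomicLatticeResolution hF hne hpos hinc⟩
  · have h := R.boundaryStable (R.upTo_elementsOfDegree μ)
    exact ⟨h, R.frameSame (R.upTo_elementsOfDegree μ) h, fun _ _ => rfl⟩
  · have h := R.boundaryStable (R.below_elementsOfDegree μ)
    exact ⟨h, R.frameSame (R.below_elementsOfDegree μ) h, fun _ _ => rfl⟩
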